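/- **Proposition 4.1.** Consider the following fourteen points of $\mathbb Z^5\oplus\mathbb Z^2$: $$\begin{array}{lll} P_0=(3,0,0,-1,-1,0,1), & P_1=(0,3,0,-1,-1,0,1), & P_2=(0,0,3,-1,-1,0,1),\\ P_3=(-1,-1,-1,3,0,1,0), & P_4=(-1,-1,-1,0,3,1,0), & P_5=(-1,-1,-1,0,0,1,0),\\ P_6=(2,-1,-1,0,0,1,0), & P_7=(-1,2,-1,0,0,1,0), & P_8=(-1,-1,2,0,0,1,0),\\ P_9=(0,0,0,2,-1,0,1), & P_{10}=(0,0,0,-1,2,0,1), & P_{11}=(0,0,0,-1,-1,0,1),\\ S_1=(0,0,0,0,0,1,0), & S_2=(0,0,0,0,0,0,1). & \end{array}$$ They are the primitive ray generators of the fan of $\operatorname{tot}(\mathcal O_{X_\nabla}(-D_b')\oplus\mathcal O_{X_\nabla}(-D_a'))$, where $X_\nabla$ is the Batyrev–Borisov mirror toric variety whose rays are generated by the projections $u_{\rho_i}\in\mathbb Z^5$ of $P_i$ ($0\le i\le 11$) to the first five coordinates, $D_i'$ is the torus-invariant divisor of the ray of $u_{\rho_i}$, $D_a'=D_0'+D_1'+D_2'+D_9'+D_{10}'+D_{11}'$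 and $D_b'=D_3'+\dots+D_8'$. Let $G\subset(\mathbb C^*)^{14}$ be the group of the Cox construction for these rays, and let $\widehat G$ be its character group. The GKZ fan in $\widehat G\otimes\mathbb R$ is the fan of the closures of the sets of characters with a given nonempty semistable locus in $\mathbb C^{14}$; its maximal cones are called chambers. A chamber corresponds to the regular triangulation of $\operatorname{Conv}(P_0,\dots,P_{11},S_1,S_2)$, with vertices among the fourteen points, that is induced (through lower facets) by the weight vectors $w\in\mathbb R^{14}$ whose classes in $\widehat G\otimes\mathbb R$ lie in the interior of the chamber. Triangulations are given by their maximal simplices, and simplices by their vertex sets. Let $\Sigma_{LT}$ be the fan in $\mathbb R^5$ of $X_{LT}=\mathbb P^5/G_{81}$, with maximal cones generated by any five of $u_{\rho_0},\dots,u_{\rho_5}$; let $D_i$ be the divisor on $X_{LT}$ of the ray of $u_{\rho_i}$, $D_a=D_0+D_1+D_2$ and $D_b=D_3+D_4+D_5$. The variety $\operatorname{tot}(\mathcal O_{X_{LT}}(-D_b)\oplus\mathcal O_{X_{LT}}(-D_a))$ is the toric variety of the fan in $\mathbb R^7$ consisting of the cones $\operatorname{Cone}(\{P_i\mid i\in I\}\cup\{S_1,S_2\})$,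 $I\subset\{0,\dots,5\}$, $|I|=5$, and all their faces. Then there is a chamber $\sigma_{LT}$ of the GKZ fan of $\operatorname{tot}(\mathcal O_{X_\nabla}(-D_b')\oplus\mathcal O_{X_\nabla}(-D_a'))$ such that the regular triangulation $\mathcal T$ corresponding to $\sigma_{LT}$ has the following properties. * $\mathcal T$ contains the simplices $$\mathcal T_0=\bigl\{\{P_i,S_1,S_2\mid i\in I\}\ \big|\ I\subset\{0,1,\dots,5\},\ |I|=5\bigr\}.$$ * Every simplex $T\in\mathcal T\setminus\mathcal T_0$ satisfies at least one of the following two conditions: * (A) $S_1,P_6,P_7,P_8\notin T$, and $P_j,P_{6+j}\notin T$ for some $3\le j\le5$; * (B) $S_2,P_9,P_{10},P_{11}\notin T$, and $P_j,P_{6+j}\notin T$ for some $0\le j\le2$. Moreover, the toric variety $X_\Sigma$ corresponding to $\sigma_{LT}$, that is, the toric variety of the fan $\Sigma$ of all cones over the simplices of $\mathcal T$ and their faces, is a partial compactification of $\operatorname{tot}(\mathcal O_{X_{LT}}(-D_b)\oplus\mathcal O_{X_{LT}}(-D_a))$: there is an open immersion of the latter into $X_\Sigma$ over $\mathbb C$,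 with dense image, which is the identity on the dense torus. -/

import Mathlib

open CategoryTheory CategoryTheory.Limits AlgebraicGeometry

noncomputable section

namespace GKZ

/-! ## Rational cones, fans and toric varieties

The lattice `N` is `ℤⁿ`, written `Fin n → ℤ`; the dual lattice of characters is also `ℤⁿ`,
with the standard pairing. -/

/-- A lattice vector, seen in the real vector space `N_ℝ = ℝⁿ`. -/
def toReal {n : ℕ} (u : Fin n → ℤ) : Fin n → ℝ := fun k => (u k : ℝ)

/-- The pairing of a lattice point of the dual lattice with a real vector. -/
def pairing {n : ℕ} (m : Fin n → ℤ) (x : Fin n → ℝ) : ℝ := ∑ k, (m k : ℝ) * x k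

/-- `Cone(S)`, for a set `S` of lattice vectors. -/
def coneOf {n : ℕ} (S : Set (Fin n → ℤ)) : PointedCone ℝ (Fin n → ℝ) :=
  PointedCone.hull ℝ (toReal '' S)

/-- `τ` is a face of the rational cone `σ`: `τ = σ ∩ m^⊥` for some lattice point `m` of the dual
cone of `σ`. (For rational polyhedral cones the lattice points of the dual cone cut out all the
faces.) -/
def IsFace {n : ℕ} (τ σ : PointedCone ℝ (Fin n → ℝ)) : Prop :=
  ∃ m : Fin n → ℤ, (∀ x ∈ σ, 0 ≤ pairing m x) ∧ ∀ x, x ∈ τ ↔ x ∈ σ ∧ pairing m x = 0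

/-- A fan in `ℝⁿ` with respect to the lattice `ℤⁿ`: a finite collection of strongly convex rational
polyhedral cones, closed under taking faces, any two of which meet along a common face. -/
structure Fan (n : ℕ) where
  cones : Set (PointedCone ℝ (Fin n → ℝ))
  finite : cones.Finite
  rational : ∀ σ ∈ cones, ∃ S : Set (Fin n → ℤ), S.Finite ∧ σ = coneOf S
  stronglyConvex : ∀ σ ∈ cones, ∀ x ∈ σ, -x ∈ σ → x = 0
  face_mem : ∀ σ ∈ cones, ∀ τ, IsFace τ σ → τ ∈ cones
  inter_face : ∀ σ ∈ cones, ∀ τ ∈ cones, IsFace (σ ⊓ τ) σ ∧ IsFace (σ ⊓ τ) τ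

/-- The fan `Σ` consists of the cones of the collection `S` and all their faces. -/
def Fan.IsGeneratedBy {n : ℕ} (Φ : Fan n) (S : Set (PointedCone ℝ (Fin n → ℝ))) : Prop :=
  Φ.cones = {τ | ∃ σ ∈ S, IsFace τ σ}

lemma pairing_add_right {n : ℕ} (m : Fin n → ℤ) (x y : Fin n → ℝ) :
    pairing m (x + y) = pairing m x + pairing m y := by
  simp [pairing, mul_add, Finset.sum_add_distrib]

lemma pairing_add_left {n : ℕ} (m m' : Fin n → ℤ) (x : Fin n → ℝ) :
    pairing (m + m') x = pairing m x + pairing m' x := by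
  simp [pairing, add_mul, Finset.sum_add_distrib]

lemma pairing_nsmul_left {n : ℕ} (k : ℕ) (m : Fin n → ℤ) (x : Fin n → ℝ) :
    pairing (k • m) x = k * pairing m x := by
  simp [pairing, Finset.mul_sum, mul_assoc]

/-- The semigroup `σ^∨ ∩ M` of lattice points of the dual cone. -/
def dualMonoid {n : ℕ} (σ : PointedCone ℝ (Fin n → ℝ)) : AddSubmonoid (Fin n → ℤ) where
  carrier := {m | ∀ x ∈ σ, 0 ≤ pairing m x}
  zero_mem' := fun x _ => by simp [pairing]
  add_mem' := fun ha hb x hx => by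
    rw [pairing_add_left]
    exact add_nonneg (ha x hx) (hb x hx)

lemma dualMonoid_anti {n : ℕ} {τ σ : PointedCone ℝ (Fin n → ℝ)} (h : τ ≤ σ) :
    dualMonoid σ ≤ dualMonoid τ := fun _ hm x hx => hm x (h hx)

/-- The semigroup algebra `ℂ[σ^∨ ∩ M]`. -/
abbrev chartRing {n : ℕ} (σ : PointedCone ℝ (Fin n → ℝ)) : Type :=
  AddMonoidAlgebra ℂ (dualMonoid σ)

/-- The inclusion `ℂ[σ^∨ ∩ M] → ℂ[τ^∨ ∩ M]` for `τ ⊆ σ`. -/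
def chartMap {n : ℕ} {τ σ : PointedCone ℝ (Fin n → ℝ)} (h : τ ≤ σ) :
    chartRing σ →ₐ[ℂ] chartRing τ :=
  AddMonoidAlgebra.mapDomainAlgHom ℂ ℂ (AddSubmonoid.inclusion (dualMonoid_anti h))

/-- The affine toric variety `U_σ = Spec ℂ[σ^∨ ∩ M]`. -/
abbrev chart {n : ℕ} (σ : PointedCone ℝ (Fin n → ℝ)) : Scheme.{0} :=
  Spec (CommRingCat.of (chartRing σ))

/-- The morphism `U_τ → U_σ` for `τ ⊆ σ`. -/
def chartHom {n : ℕ} {τ σ : PointedCone ℝ (Fin n → ℝ)} (h : τ ≤ σ) : chart τ ⟶ chart σ :=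
  Spec.map (CommRingCat.ofHom (chartMap h).toRingHom)

/-- The structure morphism `U_σ → Spec ℂ`. -/
def chartStr {n : ℕ} (σ : PointedCone ℝ (Fin n → ℝ)) : chart σ ⟶ Spec (CommRingCat.of ℂ) :=
  Spec.map (CommRingCat.ofHom (algebraMap ℂ (chartRing σ)))

lemma chartHom_refl {n : ℕ} (σ : PointedCone ℝ (Fin n → ℝ)) :
    chartHom (le_refl σ) = 𝟙 (chart σ) := by
  have : (chartMap (le_refl σ)).toRingHom = RingHom.id (chartRing σ) := by
    have h : AddSubmonoid.inclusion (dualMonoid_anti (le_refl σ)) = AddMonoidHom.id _ := by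
      ext x; rfl
    unfold chartMap
    rw [h]
    apply RingHom.ext
    intro x
    simp
  simp only [chartHom, this]
  exact Spec.map_id _

lemma chartHom_comp {n : ℕ} {ρ τ σ : PointedCone ℝ (Fin n → ℝ)} (h : ρ ≤ τ) (h' : τ ≤ σ) :
    chartHom h ≫ chartHom h' = chartHom (h.trans h') := by
  have : (chartMap (h.trans h')).toRingHom =
      (chartMap h).toRingHom.comp (chartMap h').toRingHom := by
    have e : AddSubmonoid.inclusion (dualMonoid_anti (h.trans h')) =
        (AddSubmonoid.inclusion (dualMonoid_anti h)).comp
          (AddSubmonoid.inclusion (dualMonoid_anti h')) := by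
      ext x; rfl
    unfold chartMap
    rw [e, AddMonoidAlgebra.mapDomainAlgHom_comp]
    rfl
  rw [chartHom, chartHom, chartHom, this, ← Spec.map_comp, ← CommRingCat.ofHom_comp]

lemma chartHom_str {n : ℕ} {τ σ : PointedCone ℝ (Fin n → ℝ)} (h : τ ≤ σ) :
    chartHom h ≫ chartStr σ = chartStr τ := by
  rw [chartHom, chartStr, chartStr, ← Spec.map_comp, ← CommRingCat.ofHom_comp]
  congr 2
  exact (chartMap h).comp_algebraMap

/-- A finitely generated cone is contained in a half space once its generators are. -/
lemma nonneg_of_generators {n : ℕ} {S : Set (Fin n → ℤ)} {w : Fin n → ℤ}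
    (h : ∀ s ∈ S, 0 ≤ pairing w (toReal s)) : ∀ x ∈ coneOf S, 0 ≤ pairing w x := by
  intro x hx
  refine Submodule.span_induction (p := fun x _ => 0 ≤ pairing w x) ?_ ?_ ?_ ?_ hx
  · rintro _ ⟨s, hs, rfl⟩
    exact h s hs
  · simp [pairing]
  · intro x y _ _ hx hy
    rw [pairing_add_right]
    exact add_nonneg hx hy
  · intro a x _ hx
    have : pairing w (a • x) = (a : ℝ) * pairing w x := by
      simp only [pairing, Finset.mul_sum]
      refine Finset.sum_congr rfl fun k _ => ?_
      change (w k : ℝ) * ((a : ℝ) * x k) = _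
      ring
    rw [this]
    exact mul_nonneg a.2 hx

lemma exists_nsmul_add_mem {n : ℕ} {τ : PointedCone ℝ (Fin n → ℝ)} {S : Set (Fin n → ℤ)}
    (hS : S.Finite) {m : Fin n → ℤ} (hm : m ∈ dualMonoid (coneOf S))
    (hτ : ∀ x, x ∈ τ ↔ x ∈ coneOf S ∧ pairing m x = 0) {w : Fin n → ℤ} (hw : w ∈ dualMonoid τ) :
    ∃ k : ℕ, w + k • m ∈ dualMonoid (coneOf S) := by
  have cast : ∀ (a s : Fin n → ℤ), pairing a (toReal s) = ((∑ i, a i * s i : ℤ) : ℝ) := by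
    intro a s; simp [pairing, toReal]
  refine ⟨∑ s ∈ hS.toFinset, (∑ i, w i * s i).natAbs, nonneg_of_generators fun s hs => ?_⟩
  have hsc : toReal s ∈ coneOf S := Submodule.subset_span ⟨s, hs, rfl⟩
  rw [pairing_add_left, pairing_nsmul_left]
  have h0 := hm _ hsc
  by_cases hz : pairing m (toReal s) = 0
  · rw [hz, mul_zero, add_zero]
    exact hw _ ((hτ _).2 ⟨hsc, hz⟩)
  · rw [cast] at h0 hz
    rw [cast, cast]
    norm_cast at h0 hz
    suffices H : (0 : ℤ) ≤ ∑ i, w i * s i +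
        ((∑ s ∈ hS.toFinset, (∑ i, w i * s i).natAbs : ℕ) : ℤ) * ∑ i, m i * s i by
      have := (Int.cast_le (R := ℝ)).2 H
      simpa only [Int.cast_zero, Int.cast_add, Int.cast_mul, Int.cast_natCast] using this
    have h1 : 1 ≤ ∑ i, m i * s i := by omega
    have h2 : (∑ i, w i * s i).natAbs ≤ ∑ s ∈ hS.toFinset, (∑ i, w i * s i).natAbs :=
      Finset.single_le_sum (f := fun s : Fin n → ℤ => (∑ i, w i * s i).natAbs)
        (fun _ _ => Nat.zero_le _) (hS.mem_toFinset.2 hs)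
    generalize (∑ s ∈ hS.toFinset, (∑ i, w i * s i).natAbs) = K at *
    have h3 : (K : ℤ) ≤ K * ∑ i, m i * s i := le_mul_of_one_le_right (by positivity) h1
    omega

lemma chartMap_single {n : ℕ} {τ σ : PointedCone ℝ (Fin n → ℝ)} (h : τ ≤ σ)
    (m : dualMonoid σ) (c : ℂ) :
    chartMap h (AddMonoidAlgebra.single m c) =
      AddMonoidAlgebra.single (⟨m.1, dualMonoid_anti h m.2⟩ : dualMonoid τ) c := by
  simp [chartMap]
  rfl

lemma chartMap_injective {n : ℕ} {τ σ : PointedCone ℝ (Fin n → ℝ)} (h : τ ≤ σ) :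
    Function.Injective (chartMap h) :=
  AddMonoidAlgebra.mapDomain_injective (AddSubmonoid.inclusion_injective (dualMonoid_anti h))

/-- For a face `τ = σ ∩ m^⊥`, the ring `ℂ[τ^∨ ∩ M]` is the localization of `ℂ[σ^∨ ∩ M]` at the
character of `m`. -/
lemma isLocalization_chart {n : ℕ} {τ σ : PointedCone ℝ (Fin n → ℝ)} (h : τ ≤ σ)
    {S : Set (Fin n → ℤ)} (hS : S.Finite) (hσ : σ = coneOf S) (m : dualMonoid σ)
    (hτ : ∀ x, x ∈ τ ↔ x ∈ σ ∧ pairing m.1 x = 0) :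
    @IsLocalization.Away _ _ (AddMonoidAlgebra.single m (1 : ℂ)) (chartRing τ) _
      (chartMap h).toRingHom.toAlgebra := by
  let _ := (chartMap h).toRingHom.toAlgebra
  have alg : ∀ x, algebraMap (chartRing σ) (chartRing τ) x = chartMap h x := fun _ => rfl
  subst hσ
  have hneg : -m.1 ∈ dualMonoid τ := by
    intro x hx
    have : pairing (-m.1) x = - pairing m.1 x := by simp [pairing]
    rw [this, ((hτ x).1 hx).2, neg_zero]
  have surj : ∀ z : chartRing τ, ∃ (k : ℕ) (y : chartRing (coneOf S)),
      z * chartMap h (AddMonoidAlgebra.single m 1 ^ k) = chartMap h y := by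
    intro z
    induction z using AddMonoidAlgebra.induction_linear with
    | zero => exact ⟨0, 0, by simp⟩
    | add f g hf hg =>
      obtain ⟨k, y, hy⟩ := hf
      obtain ⟨k', y', hy'⟩ := hg
      refine ⟨k + k', y * AddMonoidAlgebra.single m 1 ^ k' +
        y' * AddMonoidAlgebra.single m 1 ^ k, ?_⟩
      rw [map_add, map_mul, map_mul, ← hy, ← hy', pow_add, map_mul]
      ring
    | single a c =>
      obtain ⟨k, hk⟩ := exists_nsmul_add_mem hS m.2 hτ a.2
      refine ⟨k, AddMonoidAlgebra.single ⟨_, hk⟩ c, ?_⟩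
      rw [AddMonoidAlgebra.single_pow, chartMap_single, chartMap_single,
        AddMonoidAlgebra.single_mul_single]
      congr 1
      simp
  refine ⟨?_, ?_, ?_⟩
  · rintro ⟨_, k, rfl⟩
    rw [alg]
    simp only [map_pow]
    refine IsUnit.pow _ (IsUnit.of_mul_eq_one (AddMonoidAlgebra.single ⟨_, hneg⟩ 1) ?_)
    rw [chartMap_single, AddMonoidAlgebra.single_mul_single, AddMonoidAlgebra.one_def]
    congr 1
    · ext; simp
    · simp
  · intro z
    obtain ⟨k, y, hy⟩ := surj z
    exact ⟨⟨y, ⟨_, k, rfl⟩⟩, hy⟩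
  · intro x y hxy
    exact ⟨1, by rw [chartMap_injective h hxy]⟩

lemma isOpenImmersion_chartHom {n : ℕ} {τ σ : PointedCone ℝ (Fin n → ℝ)} (h : τ ≤ σ)
    {S : Set (Fin n → ℤ)} (hS : S.Finite) (hσ : σ = coneOf S) (hτ : IsFace τ σ) :
    IsOpenImmersion (chartHom h) := by
  obtain ⟨m, hm, hmτ⟩ := hτ
  let _ := (chartMap h).toRingHom.toAlgebra
  have := isLocalization_chart h hS hσ ⟨m, hm⟩ hmτ
  exact IsOpenImmersion.of_isLocalization (S := chartRing τ)
    (AddMonoidAlgebra.single (⟨m, hm⟩ : dualMonoid σ) (1 : ℂ))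

lemma range_chartHom {n : ℕ} {τ σ : PointedCone ℝ (Fin n → ℝ)} (h : τ ≤ σ)
    {S : Set (Fin n → ℤ)} (hS : S.Finite) (hσ : σ = coneOf S) (m : dualMonoid σ)
    (hτ : ∀ x, x ∈ τ ↔ x ∈ σ ∧ pairing m.1 x = 0) :
    Set.range (chartHom h) =
      (PrimeSpectrum.basicOpen (AddMonoidAlgebra.single m (1 : ℂ)) :
        Set (PrimeSpectrum (chartRing σ))) := by
  let _ := (chartMap h).toRingHom.toAlgebra
  have := isLocalization_chart h hS hσ m hτ
  exact PrimeSpectrum.localization_away_comap_range (chartRing τ)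
    (AddMonoidAlgebra.single m (1 : ℂ))

/-- The diagram of the affine charts `U_σ` of a fan, indexed by its cones. -/
def Fan.diagram {n : ℕ} (Φ : Fan n) : Φ.cones ⥤ Scheme.{0} where
  obj σ := chart σ.1
  map f := chartHom (leOfHom f)
  map_id σ := chartHom_refl σ.1
  map_comp _ _ := (chartHom_comp _ _).symm

lemma Fan.isFace_of_le {n : ℕ} (Φ : Fan n) {σ τ : Φ.cones} (h : τ ≤ σ) : IsFace τ.1 σ.1 := by
  have := (Φ.inter_face σ.1 σ.2 τ.1 τ.2).1
  rwa [inf_eq_right.2 (show τ.1 ≤ σ.1 from h)] at this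

instance Fan.diagram_isOpenImmersion {n : ℕ} (Φ : Fan n) {σ τ : Φ.cones} (f : τ ⟶ σ) :
    IsOpenImmersion (Φ.diagram.map f) := by
  obtain ⟨S, hS, hσ⟩ := Φ.rational σ.1 σ.2
  exact isOpenImmersion_chartHom (leOfHom f) hS hσ (Φ.isFace_of_le (leOfHom f))

instance Fan.diagram_isLocallyDirected {n : ℕ} (Φ : Fan n) :
    (Φ.diagram ⋙ Scheme.forget).IsLocallyDirected := by
  constructor
  intro i j k fi fj xi xj hx
  obtain ⟨S, hS, hσ⟩ := Φ.rational k.1 k.2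
  obtain ⟨m, hm, hmi⟩ := Φ.isFace_of_le (leOfHom fi)
  obtain ⟨m', hm', hmj⟩ := Φ.isFace_of_le (leOfHom fj)
  let l : Φ.cones := ⟨i.1 ⊓ j.1,
    Φ.face_mem i.1 i.2 _ (Φ.inter_face i.1 i.2 j.1 j.2).1⟩
  have hli : l ≤ i := show i.1 ⊓ j.1 ≤ i.1 from inf_le_left
  have hlj : l ≤ j := show i.1 ⊓ j.1 ≤ j.1 from inf_le_right
  have hl : ∀ x, x ∈ l.1 ↔ x ∈ k.1 ∧ pairing (m + m') x = 0 := by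
    intro x
    rw [pairing_add_left]
    constructor
    · rintro ⟨h1, h2⟩
      have a := (hmi x).1 h1
      have b := (hmj x).1 h2
      exact ⟨a.1, by rw [a.2, b.2, add_zero]⟩
    · rintro ⟨h1, h2⟩
      have a := hm x h1
      have b := hm' x h1
      exact ⟨(hmi x).2 ⟨h1, by linarith⟩, (hmj x).2 ⟨h1, by linarith⟩⟩
  have ri := range_chartHom (leOfHom fi) hS hσ ⟨m, hm⟩ hmi
  have rj := range_chartHom (leOfHom fj) hS hσ ⟨m', hm'⟩ hmj
  have rl := range_chartHom (leOfHom (homOfLE hli ≫ fi)) hS hσ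
    (⟨m, hm⟩ + ⟨m', hm'⟩ : dualMonoid k.1) hl
  have hx' : (Φ.diagram.map fi) xi = (Φ.diagram.map fj) xj := hx
  have mem : (Φ.diagram.map fi) xi ∈ Set.range (Φ.diagram.map (homOfLE hli ≫ fi)) := by
    have h1 : (Φ.diagram.map fi) xi ∈ Set.range (chartHom (leOfHom fi)) := ⟨xi, rfl⟩
    have h2 : (Φ.diagram.map fi) xi ∈ Set.range (chartHom (leOfHom fj)) := ⟨xj, hx'.symm⟩
    rw [ri] at h1
    rw [rj] at h2
    have e : (AddMonoidAlgebra.single (⟨m, hm⟩ + ⟨m', hm'⟩ : dualMonoid k.1) (1 : ℂ)) =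
        AddMonoidAlgebra.single ⟨m, hm⟩ (1 : ℂ) * AddMonoidAlgebra.single ⟨m', hm'⟩ (1 : ℂ) := by
      rw [AddMonoidAlgebra.single_mul_single, one_mul]
    have h3 : (Φ.diagram.map fi) xi ∈ Set.range (chartHom (leOfHom (homOfLE hli ≫ fi))) := by
      rw [rl, e, PrimeSpectrum.basicOpen_mul]
      exact ⟨h1, h2⟩
    exact h3
  obtain ⟨y, hy⟩ := mem
  refine ⟨l, homOfLE hli, homOfLE hlj, y, ?_, ?_⟩
  · apply (Φ.diagram.map fi).isOpenEmbedding.injective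
    rw [← hy, Functor.map_comp]
    rfl
  · apply (Φ.diagram.map fj).isOpenEmbedding.injective
    rw [← hx', ← hy, show homOfLE hli ≫ fi = homOfLE hlj ≫ fj from Subsingleton.elim _ _,
      Functor.map_comp]
    rfl

/-- The toric variety `X_Σ` of a fan: the affine charts `U_σ`, `σ ∈ Σ`, glued along the open
immersions `U_τ → U_σ` for the faces `τ` of `σ`. -/
def Fan.toricVariety {n : ℕ} (Φ : Fan n) : Scheme.{0} := colimit Φ.diagram

/-- The open chart `U_σ → X_Σ`. -/
def Fan.chartι {n : ℕ} (Φ : Fan n) (σ : PointedCone ℝ (Fin n → ℝ)) (h : σ ∈ Φ.cones) :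
    chart σ ⟶ Φ.toricVariety :=
  colimit.ι Φ.diagram ⟨σ, h⟩

/-- The structure morphism `X_Σ → Spec ℂ`. -/
def Fan.str {n : ℕ} (Φ : Fan n) : Φ.toricVariety ⟶ Spec (CommRingCat.of ℂ) :=
  colimit.desc Φ.diagram
    { pt := Spec (CommRingCat.of ℂ)
      ι := { app := fun σ => chartStr σ.1
             naturality := fun _ _ f =>
              (chartHom_str (leOfHom f)).trans (Category.comp_id _).symm } }

/-- `X_Ψ` is a (toric) partial compactification of `X_Φ`: there is an open immersion `X_Φ → X_Ψ`
over `ℂ` with dense image, which restricts to the identity on the dense torus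
`U_{0} = Spec ℂ[M]`. -/
def IsPartialCompactification {n : ℕ} (Φ Ψ : Fan n) : Prop :=
  ∃ f : Φ.toricVariety ⟶ Ψ.toricVariety,
    IsOpenImmersion f ∧ IsDominant f ∧ f ≫ Ψ.str = Φ.str ∧
    ∃ (h : ⊥ ∈ Φ.cones) (h' : ⊥ ∈ Ψ.cones), Φ.chartι ⊥ h ≫ f = Ψ.chartι ⊥ h'

/-! ## The GKZ fan

Throughout, `ν : ι → ℤⁿ` is the family of the primitive generators of the rays of a fan. -/

section GKZFan

variable {ι : Type} [Fintype ι] {n : ℕ}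

/-- The group `G = {t ∈ (ℂ^*)^ι | ∏_i t_i ^ ⟨e_k, ν_i⟩ = 1 for all k}` of the Cox construction. -/
def coxGroup (ν : ι → Fin n → ℤ) : Subgroup (ι → ℂˣ) where
  carrier := {t | ∀ k, ∏ i, t i ^ ν i k = 1}
  one_mem' := fun k => by simp
  mul_mem' := fun ha hb k => by
    simp only [Pi.mul_apply, mul_zpow, Finset.prod_mul_distrib, ha k, hb k, mul_one]
  inv_mem' := fun ha k => by
    simp only [Pi.inv_apply, inv_zpow, Finset.prod_inv_distrib, ha k, inv_one]

/-- The character `t ↦ ∏_i t_i ^ a_i` of the torus; the characters of `G` are the restrictions of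
these to `G`. -/
def torusChar (a : ι → ℤ) (t : ι → ℂˣ) : ℂˣ := ∏ i, t i ^ a i

/-- The semistable locus `(ℂ^ι)^ss_χ` of the action of `G` on `ℂ^ι`, for the character `χ` of `G`
given by `a`: the points where, for some `d > 0`, some `G`-invariant section of the linearised line
bundle `O(χ^d)` does not vanish. Such a section is a polynomial `F` with `F(t·q) = χ(t)^d F(q)`. -/
def semistable (ν : ι → Fin n → ℤ) (a : ι → ℤ) : Set (ι → ℂ) :=
  {p | ∃ d : ℕ, 0 < d ∧ ∃ F : MvPolynomial ι ℂ,
    (∀ t ∈ coxGroup ν, ∀ q : ι → ℂ,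
      MvPolynomial.eval (fun i => (t i : ℂ) * q i) F =
        (torusChar a t : ℂ) ^ d * MvPolynomial.eval q F) ∧
    MvPolynomial.eval p F ≠ 0}

/-- The map `m ↦ (⟨m, ν_i⟩)_i` from the real dual space to `ℝ^ι`. -/
def charMap (ν : ι → Fin n → ℤ) : (Fin n → ℝ) →ₗ[ℝ] (ι → ℝ) :=
  LinearMap.pi fun i => Fintype.linearCombination ℝ (toReal (ν i))

/-- The space `Ĝ ⊗ ℝ` of real characters of `G`; here `Ĝ` is the cokernel of the map
`m ↦ (⟨m, ν_i⟩)_i` from the dual lattice to `ℤ^ι`. -/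
abbrev CharSpace (ν : ι → Fin n → ℤ) : Type := (ι → ℝ) ⧸ LinearMap.range (charMap ν)

/-- The class of a weight vector in `Ĝ ⊗ ℝ`. -/
def charClass (ν : ι → Fin n → ℤ) (w : ι → ℝ) : CharSpace ν :=
  (LinearMap.range (charMap ν)).mkQ w

/-- The GKZ cone of a character: the closure of the set of all (positive multiples of) characters
with the same semistable locus. -/
def gkzCone (ν : ι → Fin n → ℤ) (a : ι → ℤ) : Set (CharSpace ν) :=
  closure {x | ∃ (r : ℝ) (b : ι → ℤ), 0 < r ∧ semistable ν b = semistable ν a ∧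
    x = r • charClass ν fun i => (b i : ℝ)}

/-- The GKZ fan: the collection of the GKZ cones of the characters with nonempty semistable
locus. -/
def gkzFan (ν : ι → Fin n → ℤ) : Set (Set (CharSpace ν)) :=
  {σ | ∃ a : ι → ℤ, (semistable ν a).Nonempty ∧ σ = gkzCone ν a}

/-- The chambers are the maximal cones of the GKZ fan. -/
def IsChamber (ν : ι → Fin n → ℤ) (σ : Set (CharSpace ν)) : Prop :=
  Maximal (fun τ => τ ∈ gkzFan ν) σ

/-! ## Regular triangulations -/

/-- The points of `ℝⁿ` indexed by `I`. -/
def pts (ν : ι → Fin n → ℤ) (I : Finset ι) : Set (Fin n → ℝ) :=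
  (fun i => toReal (ν i)) '' (I : Set ι)

/-- `T`, given as a finite set of vertex sets, is (the set of maximal simplices of) a triangulation
of the convex hull of the points `ν_i`, with vertices among these points: its members are affinely
independent of full dimension, they cover the convex hull, and any two of them meet along the common
face spanned by their common vertices. -/
structure IsTriangulation (ν : ι → Fin n → ℤ) (T : Finset (Finset ι)) : Prop where
  affineIndependent : ∀ I ∈ T, AffineIndependent ℝ fun i : I => toReal (ν i)
  fullDimensional : ∀ I ∈ T,
    affineSpan ℝ (pts ν I) = affineSpan ℝ (Set.range fun i => toReal (ν i))
  cover : (⋃ I ∈ T, convexHull ℝ (pts ν I)) = convexHull ℝ (Set.range fun i => toReal (ν i))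
  inter : ∀ I ∈ T, ∀ J ∈ T, convexHull ℝ (pts ν I) ∩ convexHull ℝ (pts ν J) =
    convexHull ℝ ((fun i => toReal (ν i)) '' ((I : Set ι) ∩ (J : Set ι)))

/-- `I` is the set of all `i` for which the lifted point `(ν_i, w_i)` lies on a certain lower facet
of the convex hull of all lifted points: this facet lies on the graph of an affine function `ℓ`. -/
def IsLowerFacet (ν : ι → Fin n → ℤ) (w : ι → ℝ) (I : Finset ι) : Prop :=
  (∃ ℓ : (Fin n → ℝ) →ᵃ[ℝ] ℝ, (∀ i, ℓ (toReal (ν i)) ≤ w i) ∧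
    ∀ i, i ∈ I ↔ ℓ (toReal (ν i)) = w i) ∧
  affineSpan ℝ (pts ν I) = affineSpan ℝ (Set.range fun i => toReal (ν i))

/-- The weight vector `w` induces `T`: the members of `T` are exactly the lower facets. -/
def Induces (ν : ι → Fin n → ℤ) (w : ι → ℝ) (T : Finset (Finset ι)) : Prop :=
  ∀ I, I ∈ T ↔ IsLowerFacet ν w I

/-- Regular triangulations: those induced by some weight vector. -/
def IsRegularTriangulation (ν : ι → Fin n → ℤ) (T : Finset (Finset ι)) : Prop :=
  IsTriangulation ν T ∧ ∃ w, Induces ν w T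

/-- The triangulation `T` corresponds to the chamber `σ`: the interior of `σ` consists of the classes
of the weight vectors inducing `T`; and for each character in the interior of `σ` the
semistable locus is the complement of the zero locus of the irrelevant ideal
`⟨∏_{i ∉ I} x_i | I ∈ T⟩`, that is, the set of points `p` with `∏_{i ∉ I} p_i ≠ 0` for
some `I ∈ T`. -/
structure Corresponds (ν : ι → Fin n → ℤ) (σ : Set (CharSpace ν)) (T : Finset (Finset ι)) :
    Prop where
  interior_iff : ∀ w : ι → ℝ, charClass ν w ∈ interior σ ↔ Induces ν w T
  semistable_eq : ∀ a : ι → ℤ, charClass ν (fun i => (a i : ℝ)) ∈ interior σ →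
    semistable ν a = {p | ∃ I ∈ T, ∀ i, i ∉ I → p i ≠ 0}

end GKZFan

/-! ## Total spaces of split bundles of rank two -/

/-- The rays of the fan of `tot(O(D₁) ⊕ O(D₂))` over a toric variety with rays `u_ρ ∈ ℤ⁵`, where
`D_j = ∑_ρ a_{jρ} D_ρ`: the vectors `u_ρ - a_{1ρ} e₁ - a_{2ρ} e₂` and the two bundle
directions `e₁`, `e₂`, in `ℤ⁵ ⊕ ℤ²`. -/
def totRays {r : ℕ} (u : Fin r → Fin 5 → ℤ) (D₁ D₂ : Fin r → ℤ) :
    Fin r ⊕ Fin 2 → Fin 7 → ℤ :=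
  Sum.elim (fun i => Fin.append (u i) ![-D₁ i, -D₂ i])
    fun j => Fin.append (0 : Fin 5 → ℤ) (Pi.single j 1)

/-- The cone of the fan of the total space lying over the cone with rays `u_i`, `i ∈ I`. -/
def totCone {r : ℕ} (u : Fin r → Fin 5 → ℤ) (D₁ D₂ : Fin r → ℤ) (I : Finset (Fin r)) :
    PointedCone ℝ (Fin 7 → ℝ) :=
  coneOf (totRays u D₁ D₂ '' (Sum.inl '' (I : Set (Fin r)) ∪ Set.range Sum.inr))

/-- The primitive generators of the rays of `Σ_∇`. -/
def rho : Fin 12 → Fin 5 → ℤ :=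
  ![![3, 0, 0, -1, -1], ![0, 3, 0, -1, -1], ![0, 0, 3, -1, -1],
    ![-1, -1, -1, 3, 0], ![-1, -1, -1, 0, 3], ![-1, -1, -1, 0, 0],
    ![2, -1, -1, 0, 0], ![-1, 2, -1, 0, 0], ![-1, -1, 2, 0, 0],
    ![0, 0, 0, 2, -1], ![0, 0, 0, -1, 2], ![0, 0, 0, -1, -1]]

/-- `D_a' = D_0' + D_1' + D_2' + D_9' + D_10' + D_11'`. -/
def divA : Fin 12 → ℤ := ![1, 1, 1, 0, 0, 0, 0, 0, 0, 1, 1, 1]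

/-- `D_b' = D_3' + D_4' + D_5' + D_6' + D_7' + D_8'`. -/
def divB : Fin 12 → ℤ := ![0, 0, 0, 1, 1, 1, 1, 1, 1, 0, 0, 0]

/-- The fourteen rays of the fan of `tot(O_{X_∇}(-D_b') ⊕ O_{X_∇}(-D_a'))`. -/
def nabla : Fin 12 ⊕ Fin 2 → Fin 7 → ℤ := totRays rho (-divB) (-divA)

/-- The index of the point `P_i`. -/
abbrev P (i : Fin 12) : Fin 12 ⊕ Fin 2 := Sum.inl i

/-- The index of the point `S_1`. -/
abbrev S₁ : Fin 12 ⊕ Fin 2 := Sum.inr 0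

/-- The index of the point `S_2`. -/
abbrev S₂ : Fin 12 ⊕ Fin 2 := Sum.inr 1

/-- The fourteen points in coordinates. -/
lemma nabla_eq : (∀ i, nabla (P i) =
      ![![3, 0, 0, -1, -1, 0, 1], ![0, 3, 0, -1, -1, 0, 1], ![0, 0, 3, -1, -1, 0, 1],
        ![-1, -1, -1, 3, 0, 1, 0], ![-1, -1, -1, 0, 3, 1, 0], ![-1, -1, -1, 0, 0, 1, 0],
        ![2, -1, -1, 0, 0, 1, 0], ![-1, 2, -1, 0, 0, 1, 0], ![-1, -1, 2, 0, 0, 1, 0],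
        ![0, 0, 0, 2, -1, 0, 1], ![0, 0, 0, -1, 2, 0, 1], ![0, 0, 0, -1, -1, 0, 1]] i) ∧
    nabla S₁ = ![0, 0, 0, 0, 0, 1, 0] ∧ nabla S₂ = ![0, 0, 0, 0, 0, 0, 1] := by
  decide

/-- The primitive generators `u_{ρ_0}, …, u_{ρ_5}` of the rays of the fan `Σ_LT` of
`X_LT = ℙ⁵/G₈₁`. -/
def rhoLT : Fin 6 → Fin 5 → ℤ :=
  ![![3, 0, 0, -1, -1], ![0, 3, 0, -1, -1], ![0, 0, 3, -1, -1],
    ![-1, -1, -1, 3, 0], ![-1, -1, -1, 0, 3], ![-1, -1, -1, 0, 0]]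

/-- `D_a = D_0 + D_1 + D_2`. -/
def divALT : Fin 6 → ℤ := ![1, 1, 1, 0, 0, 0]

/-- `D_b = D_3 + D_4 + D_5`. -/
def divBLT : Fin 6 → ℤ := ![0, 0, 0, 1, 1, 1]

/-- The maximal cones of the fan of `tot(O_{X_LT}(-D_b) ⊕ O_{X_LT}(-D_a))`; the maximal cones of
`Σ_LT` are generated by any five of its six rays. -/
def maxConesLT : Set (PointedCone ℝ (Fin 7 → ℝ)) :=
  {σ | ∃ I : Finset (Fin 6), I.card = 5 ∧ σ = totCone rhoLT (-divBLT) (-divALT) I}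

/-- The cones over the simplices of a triangulation of the fourteen points. -/
def simplexCones (T : Finset (Finset (Fin 12 ⊕ Fin 2))) : Set (PointedCone ℝ (Fin 7 → ℝ)) :=
  {σ | ∃ I ∈ T, σ = coneOf (nabla '' (I : Set (Fin 12 ⊕ Fin 2)))}

/-- The simplices `{P_i, S_1, S_2 | i ∈ I}`, for `I ⊆ {0, …, 5}` with five elements. -/
def T₀ : Finset (Finset (Fin 12 ⊕ Fin 2)) :=
  ((Finset.univ.filter fun i : Fin 12 => i ≤ 5).powersetCard 5).image
    fun I => I.image P ∪ {S₁, S₂}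

/-- `S_1, P_6, P_7, P_8 ∉ I` and `P_j, P_{6+j} ∉ I` for some `3 ≤ j ≤ 5`. -/
def CondA (I : Finset (Fin 12 ⊕ Fin 2)) : Prop :=
  S₁ ∉ I ∧ P 6 ∉ I ∧ P 7 ∉ I ∧ P 8 ∉ I ∧
    ∃ j : Fin 12, 3 ≤ j ∧ j ≤ 5 ∧ P j ∉ I ∧ P (6 + j) ∉ I

/-- `S_2, P_9, P_10, P_11 ∉ I` and `P_j, P_{6+j} ∉ I` for some `0 ≤ j ≤ 2`. -/
def CondB (I : Finset (Fin 12 ⊕ Fin 2)) : Prop :=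
  S₂ ∉ I ∧ P 9 ∉ I ∧ P 10 ∉ I ∧ P 11 ∉ I ∧
    ∃ j : Fin 12, j ≤ 2 ∧ P j ∉ I ∧ P (6 + j) ∉ I

end GKZ

end

/-! The triangulation has 18 explicit simplices and is induced by an explicit integral weight.
Everything follows from a finite certificate, `IsRegularComplex`, with two halves. Each simplex is a
basis of ℝ⁷, and the functional interpolating the weight on it stays strictly below the weight at
the other points. Conversely, a set of points contained in no simplex contains the negative part of
a linear relation along which the weight decreases.

Linear programming turns the certificate into geometry. Among the nonnegative combinations with a
given value, a compact set because all points have height one, one of least weight is carried by a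
simplex; otherwise a relation would lower its weight. So the cones over the simplices cover
(`IsRegularComplex.exists_cover`). Complementary slackness (`Supports.mem_of_sum_eq`) then shows
that points at which some functional below the weight is tight lie in a common simplex
(`IsRegularComplex.exists_subset_of_tight`). This gives the triangulation, the simplicial fan, and
the fact that the weights inducing the triangulation form an open cone, the lifting cone.

For the chamber, a monomial of an invariant section not vanishing at a point p yields a functional
below the character and tight at the zeros of p; conversely, an integral functional below a multiple
of the character yields a monomial section. Hence characters in the lifting cone all have the locus
`stableSet T`, characters with this locus lie in the closed lifting cone, and the chamber is the
closed lifting cone modulo linear functionals.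

Finally, the cones over `T₀` form a subfan. Inclusion of the gluing diagrams gives the open
immersion, which is dense because the torus is already dense in every chart. -/

namespace GKZ

/-! ### Simplicial bases and regular complexes: linear programming on a vector configuration. -/

section Complex

variable {ι : Type} {n : ℕ}

lemma charMap_apply (ν : ι → Fin n → ℤ) (m : Fin n → ℝ) (i : ι) :
    charMap ν m i = ∑ k, m k * (ν i k : ℝ) := by
  simp [charMap, Fintype.linearCombination_apply, toReal]

lemma pairing_toReal (m : Fin n → ℤ) (u : Fin n → ℤ) :
    pairing m (toReal u) = ((∑ k, m k * u k : ℤ) : ℝ) := by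
  simp [pairing, toReal]

lemma pairing_eq_charMap (ν : ι → Fin n → ℤ) (m : Fin n → ℤ) (i : ι) :
    pairing m (toReal (ν i)) = charMap ν (toReal m) i := by
  simp [pairing, toReal, charMap_apply]

/-- The pairing as a linear functional of its second argument. -/
def pairingₗ (m : Fin n → ℤ) : (Fin n → ℝ) →ₗ[ℝ] ℝ :=
  Fintype.linearCombination ℝ (fun k => (m k : ℝ))

lemma pairingₗ_apply (m : Fin n → ℤ) (x : Fin n → ℝ) : pairingₗ m x = pairing m x := by
  simp [pairingₗ, Fintype.linearCombination_apply, pairing, mul_comm]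

lemma pairing_sum (m : Fin n → ℤ) (s : Finset ι) (c : ι → ℝ) (v : ι → Fin n → ℝ) :
    pairing m (∑ i ∈ s, c i • v i) = ∑ i ∈ s, c i * pairing m (v i) := by
  simp [← pairingₗ_apply]

/-- The vectors `ν i`, `i ∈ I`, form a basis of the real space, as witnessed by an integral multiple
of the dual basis. -/
def IsRationalBasis (ν : ι → Fin n → ℤ) (I : Finset ι) : Prop :=
  I.card = n ∧ ∃ (N : ℤ) (m : ι → Fin n → ℤ), 0 < N ∧ (∀ i ∈ I, ∑ k, m i k * ν i k = N) ∧
    ∀ i ∈ I, ∀ j ∈ I, i ≠ j → ∑ k, m i k * ν j k = 0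

lemma IsRationalBasis.eq_zero_of_sum {ν : ι → Fin n → ℤ} {I : Finset ι}
    (hI : IsRationalBasis ν I) {c : ι → ℝ}
    (h : ∑ i ∈ I, c i • toReal (ν i) = 0) : ∀ i ∈ I, c i = 0 := by
  obtain ⟨-, N, m, hN, hd, ho⟩ := hI
  intro i hi
  have := congrArg (pairing (m i)) h
  rw [pairing_sum, Finset.sum_eq_single i] at this
  · rw [pairing_toReal, hd i hi] at this
    have hN' : (N : ℝ) ≠ 0 := by exact_mod_cast hN.ne'
    simpa [pairing, hN'] using this
  · intro j hj hji
    rw [pairing_toReal, ho i hi j hj hji.symm]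
    simp
  · exact fun h => absurd hi h

/-- Prescribed values on `I` are interpolated by a real linear functional, depending linearly on
the values. -/
lemma IsRationalBasis.exists_interpolation {ν : ι → Fin n → ℤ} {I : Finset ι}
    (hI : IsRationalBasis ν I) :
    ∃ M : (ι → ℝ) →ₗ[ℝ] Fin n → ℝ, ∀ w, ∀ i ∈ I, charMap ν (M w) i = w i := by
  obtain ⟨-, N, m, hN, hd, ho⟩ := hI
  -- The vectors `m j`, divided by `N`, are the dual basis.
  refine ⟨∑ j ∈ I, (LinearMap.proj j).smulRight ((N : ℝ)⁻¹ • toReal (m j)), fun w i hi => ?_⟩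
  simp only [LinearMap.sum_apply, LinearMap.smulRight_apply, LinearMap.proj_apply, map_sum,
    map_smul, Finset.sum_apply, Pi.smul_apply, smul_eq_mul]
  rw [Finset.sum_eq_single i]
  · rw [← pairing_eq_charMap, pairing_toReal, hd i hi]
    have hN' : (N : ℝ) ≠ 0 := by exact_mod_cast hN.ne'
    field_simp
  · intro j hj hji
    rw [← pairing_eq_charMap, pairing_toReal, ho j hj i hi hji]
    simp
  · exact fun h => absurd hi h

lemma IsRationalBasis.linearIndependent {ν : ι → Fin n → ℤ} {I : Finset ι}
    (hI : IsRationalBasis ν I) :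
    LinearIndependent ℝ fun i : I => toReal (ν i) := by
  classical
  rw [Fintype.linearIndependent_iff]
  intro g hg i
  have := hI.eq_zero_of_sum (c := fun i => if h : i ∈ I then g ⟨i, h⟩ else 0) (by
    rw [← Finset.sum_coe_sort I, ← hg]
    exact Finset.sum_congr rfl fun i _ => by simp) i i.2
  simpa using this

lemma IsRationalBasis.span_eq_top {ν : ι → Fin n → ℤ} {I : Finset ι}
    (hI : IsRationalBasis ν I) :
    Submodule.span ℝ (Set.range fun i : I => toReal (ν i)) = ⊤ :=
  hI.linearIndependent.span_eq_top_of_card_eq_finrank' (by simp [hI.1])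

/-- Prescribed integral values on `I` are interpolated by an integral linear functional, after
multiplication by a positive integer. -/
lemma IsRationalBasis.exists_int_eq {ν : ι → Fin n → ℤ} {I : Finset ι}
    (hI : IsRationalBasis ν I) (w : ι → ℤ) :
    ∃ (d : ℕ) (m : Fin n → ℤ), 0 < d ∧ ∀ i ∈ I, ∑ k, m k * ν i k = d * w i := by
  obtain ⟨-, N, m, hN, hd, ho⟩ := hI
  -- Without dividing by `N` the functional stays integral, at the price of the factor `d = N`.
  refine ⟨N.toNat, ∑ j ∈ I, w j • m j, by omega, fun i hi => ?_⟩
  rw [Int.toNat_of_nonneg hN.le]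
  simp only [Finset.sum_apply, Finset.sum_mul]
  rw [Finset.sum_comm, Finset.sum_eq_single i]
  · simp only [Pi.smul_apply, smul_eq_mul, mul_assoc, ← Finset.mul_sum, hd i hi]
    ring
  · intro j hj hji
    simp only [Pi.smul_apply, smul_eq_mul, mul_assoc, ← Finset.mul_sum, ho j hj i hi hji, mul_zero]
  · exact fun h => absurd hi h

/-- The linear functional `m` cuts out the lower facet `I` of the points lifted by `w`. -/
def Supports (ν : ι → Fin n → ℤ) (w : ι → ℝ) (I : Finset ι) (m : Fin n → ℝ) : Prop :=
  (∀ i ∈ I, charMap ν m i = w i) ∧ ∀ i ∉ I, charMap ν m i < w i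

lemma Supports.le {ν : ι → Fin n → ℤ} {w : ι → ℝ} {I : Finset ι} {m : Fin n → ℝ}
    (h : Supports ν w I m) (i : ι) : charMap ν m i ≤ w i := by
  by_cases hi : i ∈ I
  · exact (h.1 i hi).le
  · exact (h.2 i hi).le

variable [Fintype ι]

/-- Pairing a real dual vector with a combination of the vectors `ν i`. -/
lemma sum_mul_charMap (ν : ι → Fin n → ℤ) (m : Fin n → ℝ) (c : ι → ℝ) :
    ∑ i, c i * charMap ν m i = ∑ k, m k * (∑ i, c i • toReal (ν i)) k := by
  simp only [charMap_apply, Finset.mul_sum, Finset.sum_apply, Pi.smul_apply, toReal, smul_eq_mul]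
  rw [Finset.sum_comm]
  exact Finset.sum_congr rfl fun k _ => Finset.sum_congr rfl fun i _ => by ring

namespace IsRationalBasis

variable {ν : ι → Fin n → ℤ} {I : Finset ι}

lemma eq_of_sum_eq (hI : IsRationalBasis ν I) {c c' : ι → ℝ} (hc : ∀ i ∉ I, c i = 0)
    (hc' : ∀ i ∉ I, c' i = 0)
    (h : ∑ i, c i • toReal (ν i) = ∑ i, c' i • toReal (ν i)) : c = c' := by
  have key : ∑ i ∈ I, (c i - c' i) • toReal (ν i) = 0 := by
    rw [Finset.sum_subset (Finset.subset_univ I)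
      (fun i _ hi => by rw [hc i hi, hc' i hi, sub_zero, zero_smul])]
    simp only [sub_smul, Finset.sum_sub_distrib, h, sub_self]
  funext i
  by_cases hi : i ∈ I
  · exact sub_eq_zero.1 (hI.eq_zero_of_sum key i hi)
  · rw [hc i hi, hc' i hi]

lemma exists_sum_eq (hI : IsRationalBasis ν I) (x : Fin n → ℝ) :
    ∃ c : ι → ℝ, (∀ i ∉ I, c i = 0) ∧ ∑ i, c i • toReal (ν i) = x := by
  classical
  have hx : x ∈ Submodule.span ℝ (Set.range fun i : I => toReal (ν i)) := by
    rw [hI.span_eq_top]; trivial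
  obtain ⟨c, rfl⟩ := (Submodule.mem_span_range_iff_exists_fun ℝ).1 hx
  refine ⟨fun i => if h : i ∈ I then c ⟨i, h⟩ else 0, fun i hi => by simp [hi], ?_⟩
  rw [← Finset.sum_subset (Finset.subset_univ I) (fun i _ hi => by simp [hi]),
    ← Finset.sum_coe_sort I]
  exact Finset.sum_congr rfl fun i _ => by simp

/-- A linear functional is determined by its values on `I`. -/
lemma charMap_ext (hI : IsRationalBasis ν I) {m m' : Fin n → ℝ}
    (h : ∀ i ∈ I, charMap ν m i = charMap ν m' i) (i : ι) : charMap ν m i = charMap ν m' i := by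
  classical
  obtain ⟨c, hc, he⟩ := hI.exists_sum_eq (toReal (ν i))
  have key : ∀ m : Fin n → ℝ, charMap ν m i = ∑ j, c j * charMap ν m j := by
    intro m
    rw [sum_mul_charMap, he, charMap_apply]
    rfl
  rw [key, key]
  refine Finset.sum_congr rfl fun j _ => ?_
  by_cases hj : j ∈ I
  · rw [h j hj]
  · rw [hc j hj, zero_mul, zero_mul]

end IsRationalBasis

/-- The weights for which every member of `T` is a lower facet. -/
def liftingCone (ν : ι → Fin n → ℤ) (T : Finset (Finset ι)) : Set (ι → ℝ) :=
  {w | ∀ I ∈ T, ∃ m, Supports ν w I m}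

/-- A collection `T` of rational bases among vectors at height one, which are lower facets for the
weight `w₀` and such that any set of vectors not contained in a member of `T` contains the negative
part of a relation along which `w₀` decreases. -/
structure IsRegularComplex (ν : ι → Fin n → ℤ) (T : Finset (Finset ι)) (w₀ : ι → ℝ)
    (h : Fin n → ℝ) : Prop where
  height : ∀ i, charMap ν h i = 1
  basis : ∀ I ∈ T, IsRationalBasis ν I
  mem_liftingCone : w₀ ∈ liftingCone ν T
  improve : ∀ J : Finset ι, (∀ I ∈ T, ¬ J ⊆ I) → ∃ μ : ι → ℝ,
    ∑ i, μ i • toReal (ν i) = 0 ∧ (∀ i, μ i < 0 → i ∈ J) ∧ ∑ i, μ i * w₀ i < 0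

/-- If two nonnegative combinations have the same value, one is carried by a lower facet `I` and the
other by vectors on which some functional below the weights is tight, then both are carried by
`I`. -/
lemma Supports.mem_of_sum_eq {ν : ι → Fin n → ℤ} {w : ι → ℝ} {I : Finset ι}
    {m m' : Fin n → ℝ} (hI : Supports ν w I m) (hm' : ∀ i, charMap ν m' i ≤ w i)
    {c c' : ι → ℝ} (hc' : ∀ i, 0 ≤ c' i)
    (hcI : ∀ i ∉ I, c i = 0) (hc : ∀ i, 0 ≤ c i) (hcm : ∀ i, c' i ≠ 0 → charMap ν m' i = w i)
    (h : ∑ i, c i • toReal (ν i) = ∑ i, c' i • toReal (ν i)) {i : ι} (hi : c' i ≠ 0) : i ∈ I := by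
  -- Complementary slackness: Σ c'w = Σ c·m' ≤ Σ cw = Σ c'·m ≤ Σ c'w, where the last inequality
  -- would be strict if c' charged a vector off `I`.
  have e1 : ∑ i, c' i * charMap ν m i = ∑ i, c i * w i := by
    rw [sum_mul_charMap, ← h, ← sum_mul_charMap]
    refine Finset.sum_congr rfl fun i _ => ?_
    by_cases hi : i ∈ I
    · rw [hI.1 i hi]
    · rw [hcI i hi, zero_mul, zero_mul]
  have e2 : ∑ i, c i * charMap ν m' i = ∑ i, c' i * w i := by
    rw [sum_mul_charMap, h, ← sum_mul_charMap]
    refine Finset.sum_congr rfl fun i _ => ?_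
    by_cases hi : c' i = 0
    · rw [hi, zero_mul, zero_mul]
    · rw [hcm i hi]
  have e3 : ∑ i, c i * charMap ν m' i ≤ ∑ i, c i * w i :=
    Finset.sum_le_sum fun i _ => mul_le_mul_of_nonneg_left (hm' i) (hc i)
  by_contra hiI
  have e4 : ∑ i, c' i * charMap ν m i < ∑ i, c' i * w i :=
    Finset.sum_lt_sum (fun i _ => mul_le_mul_of_nonneg_left (hI.le i) (hc' i))
      ⟨i, Finset.mem_univ i, mul_lt_mul_of_pos_left (hI.2 i hiI) ((hc' i).lt_of_ne' hi)⟩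
  linarith

namespace IsRegularComplex

variable {ν : ι → Fin n → ℤ} {T : Finset (Finset ι)} {w₀ : ι → ℝ} {h : Fin n → ℝ}

/-- Height one makes the total coefficient a linear function of the value. This bounds the fibres of
nonnegative combinations and lets linear statements pass to affine ones. -/
lemma sum_eq_of_sum_eq (hT : IsRegularComplex ν T w₀ h) {c c' : ι → ℝ}
    (e : ∑ i, c i • toReal (ν i) = ∑ i, c' i • toReal (ν i)) : ∑ i, c i = ∑ i, c' i := by
  have h1 : ∀ c : ι → ℝ, ∑ i, c i = ∑ k, h k * (∑ i, c i • toReal (ν i)) k := by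
    intro c
    rw [← sum_mul_charMap]
    simp [hT.height]
  rw [h1 c, h1 c', e]

/-- The cones over the members of `T` cover the cone of all the vectors. -/
lemma exists_cover (hT : IsRegularComplex ν T w₀ h) (c : ι → ℝ) (hc : ∀ i, 0 ≤ c i) :
    ∃ I ∈ T, ∃ c' : ι → ℝ, (∀ i, 0 ≤ c' i) ∧ (∀ i ∉ I, c' i = 0) ∧
      ∑ i, c' i • toReal (ν i) = ∑ i, c i • toReal (ν i) := by
  classical
  let K : Set (ι → ℝ) := {c' | (∀ i, 0 ≤ c' i) ∧
    ∑ i, c' i • toReal (ν i) = ∑ i, c i • toReal (ν i)}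
  have hK : IsCompact K := by
    refine Metric.isCompact_of_isClosed_isBounded ?_ ?_
    · exact (isClosed_Ici (a := (0 : ι → ℝ))).inter (isClosed_eq (by fun_prop) continuous_const)
    · refine (Metric.isBounded_Icc (0 : ι → ℝ) (fun _ => ∑ i, c i)).subset ?_
      rintro c' ⟨h0, h1⟩
      refine ⟨h0, fun i => ?_⟩
      change c' i ≤ ∑ i, c i
      rw [← hT.sum_eq_of_sum_eq h1]
      exact Finset.single_le_sum (fun i _ => h0 i) (Finset.mem_univ i)
  -- The required combination is one of least weight in the fibre.
  obtain ⟨c', ⟨h0, h1⟩, hmin⟩ := hK.exists_isMinOn ⟨c, hc, rfl⟩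
    (f := fun c' : ι → ℝ => ∑ i, c' i * w₀ i) (by fun_prop)
  let J : Finset ι := Finset.univ.filter fun i => c' i ≠ 0
  by_cases hJ : ∃ I ∈ T, J ⊆ I
  · obtain ⟨I, hI, hJI⟩ := hJ
    refine ⟨I, hI, c', h0, fun i hi => ?_, h1⟩
    by_contra hne
    exact hi (hJI (by simp [J, hne]))
  · push Not at hJ
    obtain ⟨μ, hμ, hneg, hlt⟩ := hT.improve J hJ
    -- A small step along `μ` keeps all coefficients nonnegative, since `μ` is negative only where
    -- `c'` is positive; the step lowers the weight and contradicts minimality.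
    obtain ⟨t, ht, htle⟩ : ∃ t : ℝ, 0 < t ∧ ∀ i, 0 ≤ c' i + t * μ i := by
      have hev : ∀ i, ∀ᶠ t in nhdsWithin (0 : ℝ) (Set.Ioi 0), 0 ≤ c' i + t * μ i := by
        intro i
        by_cases hi : 0 ≤ μ i
        · filter_upwards [self_mem_nhdsWithin] with t ht
          have : 0 < t := ht
          have := h0 i
          positivity
        · have hpos : 0 < c' i := by
            have := hneg i (not_le.1 hi)
            simp only [J, Finset.mem_filter, Finset.mem_univ, true_and] at this
            exact (h0 i).lt_of_ne' this
          have hcont : Continuous fun t : ℝ => c' i + t * μ i := by fun_prop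
          have := (hcont.tendsto 0).mono_left (nhdsWithin_le_nhds (s := Set.Ioi 0))
          simp only [zero_mul, add_zero] at this
          exact (this.eventually (lt_mem_nhds hpos)).mono fun t => le_of_lt
      obtain ⟨t, h1, h2⟩ := ((Filter.eventually_all.2 hev).and self_mem_nhdsWithin).exists
      exact ⟨t, h2, h1⟩
    have hmem : (fun i => c' i + t * μ i) ∈ K := by
      refine ⟨htle, ?_⟩
      simp only [add_smul, mul_smul, Finset.sum_add_distrib, ← Finset.smul_sum, hμ, smul_zero,
        add_zero, h1]
    have := hmin hmem
    simp only [add_mul, mul_assoc, Finset.sum_add_distrib, ← Finset.mul_sum,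
      Set.mem_ofPred_eq] at this
    nlinarith

/-- A set of vectors on which a supporting functional is tight is contained in a member of `T`. -/
lemma exists_subset_of_tight (hT : IsRegularComplex ν T w₀ h) {w : ι → ℝ}
    (hw : w ∈ liftingCone ν T) (J : Finset ι) (m : Fin n → ℝ) (hm : ∀ i, charMap ν m i ≤ w i)
    (hJ : ∀ i ∈ J, charMap ν m i = w i) : ∃ I ∈ T, J ⊆ I := by
  classical
  -- The sum of the vectors of `J` lies over some `I ∈ T`; slackness then forces every vector of `J`
  -- into `I`.
  obtain ⟨I, hI, c', h0, hcI, he⟩ := hT.exists_cover (fun i => if i ∈ J then 1 else 0)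
    (fun i => by split_ifs <;> simp)
  obtain ⟨m', hm'⟩ := hw I hI
  refine ⟨I, hI, fun i hi => ?_⟩
  refine hm'.mem_of_sum_eq hm (c' := fun i => if i ∈ J then 1 else 0)
    (fun i => by split_ifs <;> simp) hcI h0 (fun i hi => hJ i ?_) he (by simp [hi])
  by_contra h
  simp [h] at hi

lemma nonempty (hT : IsRegularComplex ν T w₀ h) : T.Nonempty := by
  obtain ⟨I, hI, -⟩ := hT.exists_cover 0 (fun _ => le_rfl)
  exact ⟨I, hI⟩

end IsRegularComplex

end Complex

/-! ### A regular complex is a regular triangulation. -/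

section Triangulation

variable {ι : Type} [Fintype ι] {n : ℕ}

lemma mem_convexHull_pts_iff {ν : ι → Fin n → ℤ} {I : Finset ι} {x : Fin n → ℝ} :
    x ∈ convexHull ℝ (pts ν I) ↔ ∃ c : ι → ℝ, (∀ i, 0 ≤ c i) ∧ (∀ i ∉ I, c i = 0) ∧
      ∑ i, c i = 1 ∧ ∑ i, c i • toReal (ν i) = x := by
  classical
  constructor
  · intro hx
    have hsub : convexHull ℝ (pts ν I) ⊆ {x | ∃ c : ι → ℝ, (∀ i, 0 ≤ c i) ∧ (∀ i ∉ I, c i = 0) ∧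
      ∑ i, c i = 1 ∧ ∑ i, c i • toReal (ν i) = x} := by
      refine convexHull_min ?_ ?_
      · rintro _ ⟨i, hi, rfl⟩
        refine ⟨Pi.single i 1, fun j => ?_, fun j hj => ?_, ?_, ?_⟩
        · by_cases h : j = i
          · subst h; simp
          · simp [h]
        · have : j ≠ i := by rintro rfl; exact hj hi
          simp [this]
        · simp
        · simp [Pi.single_apply, ite_smul]
      · rintro _ ⟨c, h0, hI, h1, rfl⟩ _ ⟨c', h0', hI', h1', rfl⟩ a b ha hb hab
        refine ⟨fun i => a * c i + b * c' i, fun i => ?_, fun i hi => ?_, ?_, ?_⟩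
        · have := h0 i; have := h0' i; positivity
        · simp [hI i hi, hI' i hi]
        · simp [Finset.sum_add_distrib, ← Finset.mul_sum, h1, h1', hab]
        · simp [add_smul, mul_smul, Finset.sum_add_distrib, ← Finset.smul_sum]
    exact hsub hx
  · rintro ⟨c, h0, hI, h1, rfl⟩
    have e := Finset.sum_subset (Finset.subset_univ I) (f := c) (fun i _ hi => hI i hi)
    rw [← Finset.sum_subset (Finset.subset_univ I)
      (fun i _ hi => by rw [hI i hi, zero_smul])]
    exact (convex_convexHull ℝ _).sum_mem (fun i _ => h0 i) (e.trans h1)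
      fun i hi => subset_convexHull ℝ _ ⟨i, hi, rfl⟩

lemma convexHull_range_eq_pts (ν : ι → Fin n → ℤ) :
    convexHull ℝ (Set.range fun i => toReal (ν i)) = convexHull ℝ (pts ν Finset.univ) := by
  simp [pts]

namespace IsRegularComplex

variable {ν : ι → Fin n → ℤ} {T : Finset (Finset ι)} {w₀ : ι → ℝ} {h : Fin n → ℝ}

lemma affineIndependent (hT : IsRegularComplex ν T w₀ h) {I : Finset ι} (hI : I ∈ T) :
    AffineIndependent ℝ fun i : I => toReal (ν i) :=
  (hT.basis I hI).linearIndependent.affineIndependent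

lemma affineSpan_eq (hT : IsRegularComplex ν T w₀ h) {I : Finset ι} (hI : I ∈ T) :
    affineSpan ℝ (pts ν I) = affineSpan ℝ (Set.range fun i => toReal (ν i)) := by
  classical
  apply le_antisymm
  · refine affineSpan_mono ℝ ?_
    rintro _ ⟨i, -, rfl⟩
    exact ⟨i, rfl⟩
  · refine affineSpan_le.2 ?_
    rintro _ ⟨j, rfl⟩
    obtain ⟨c, hc, he⟩ := (hT.basis I hI).exists_sum_eq (toReal (ν j))
    have h1 : ∑ i, c i = 1 := by
      rw [hT.sum_eq_of_sum_eq (c' := Pi.single j 1)]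
      · simp
      · simp [he, Pi.single_apply, ite_smul]
    rw [← Finset.sum_subset (Finset.subset_univ I) (fun i _ hi => hc i hi)] at h1
    rw [← Finset.sum_subset (Finset.subset_univ I)
      (fun i _ hi => by rw [hc i hi, zero_smul])] at he
    change toReal (ν j) ∈ affineSpan ℝ (pts ν I)
    rw [← he, ← Finset.affineCombination_eq_linear_combination _ _ _ h1]
    have := affineCombination_mem_affineSpan_image (k := ℝ) (s := I) (w := c) h1
      (s' := (I : Set ι)) (fun i hi hi' => absurd hi hi') (fun i => toReal (ν i))
    exact this

/-- The weights inducing `T` form its lifting cone. -/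
lemma induces_iff (hT : IsRegularComplex ν T w₀ h) (w : ι → ℝ) :
    Induces ν w T ↔ w ∈ liftingCone ν T := by
  classical
  have lin : ∀ ℓ : (Fin n → ℝ) →ᵃ[ℝ] ℝ, ∃ m : Fin n → ℝ, ∀ i, ℓ (toReal (ν i)) = charMap ν m i := by
    intro ℓ
    -- On points of height one the constant term of an affine function is a multiple of the height
    -- functional.
    refine ⟨(fun k => ℓ.linear (Pi.single k 1)) + ℓ 0 • h, fun i => ?_⟩
    rw [map_add, map_smul, Pi.add_apply, Pi.smul_apply, hT.height, smul_eq_mul, mul_one,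
      charMap_apply, ← sub_eq_iff_eq_add]
    have hlin : ℓ (toReal (ν i)) - ℓ 0 = ℓ.linear (toReal (ν i)) := by
      simpa using (ℓ.linearMap_vsub (toReal (ν i)) 0).symm
    rw [hlin]
    conv_lhs => rw [← Finset.univ_sum_single (toReal (ν i))]
    rw [map_sum]
    refine Finset.sum_congr rfl fun k _ => ?_
    have : (Pi.single k (toReal (ν i) k) : Fin n → ℝ) = (ν i k : ℝ) • Pi.single k (1 : ℝ) := by
      rw [← Pi.single_smul, smul_eq_mul, mul_one, toReal]
    rw [this, map_smul, smul_eq_mul, mul_comm]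
  constructor
  · intro hw I hI
    obtain ⟨⟨ℓ, hle, heq⟩, -⟩ := (hw I).1 hI
    obtain ⟨m, hm⟩ := lin ℓ
    simp only [hm] at hle heq
    exact ⟨m, fun i hi => (heq i).1 hi, fun i hi => (hle i).lt_of_ne fun e => hi ((heq i).2 e)⟩
  · intro hw I
    constructor
    · intro hI
      obtain ⟨m, hm⟩ := hw I hI
      refine ⟨⟨(Fintype.linearCombination ℝ m).toAffineMap, ?_⟩, hT.affineSpan_eq hI⟩
      have e : ∀ i, (Fintype.linearCombination ℝ m).toAffineMap (toReal (ν i)) =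
          charMap ν m i := by
        intro i
        simp [Fintype.linearCombination_apply, charMap_apply, toReal, mul_comm]
      simp only [e]
      refine ⟨hm.le, fun i => ⟨hm.1 i, fun he => ?_⟩⟩
      by_contra hi
      exact (hm.2 i hi).ne he
    · rintro ⟨⟨ℓ, hle, heq⟩, hsp⟩
      obtain ⟨m, hm⟩ := lin ℓ
      simp only [hm] at hle heq
      obtain ⟨I', hI', hsub⟩ := hT.exists_subset_of_tight hw I m hle fun i hi => (heq i).1 hi
      convert hI'
      -- A subset of an affinely independent set with the same affine span is the whole set.
      refine hsub.antisymm fun i hi => ?_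
      have hmem : toReal (ν i) ∈ affineSpan ℝ (pts ν I) := by
        rw [hsp]
        exact subset_affineSpan ℝ _ ⟨i, rfl⟩
      have hpts : pts ν I = (fun i : I' => toReal (ν i)) '' {i | i.1 ∈ I} := by
        ext x
        constructor
        · rintro ⟨j, hj, rfl⟩
          exact ⟨⟨j, hsub hj⟩, hj, rfl⟩
        · rintro ⟨j, hj, rfl⟩
          exact ⟨j.1, hj, rfl⟩
      rw [hpts] at hmem
      exact ((hT.affineIndependent hI').mem_affineSpan_iff ⟨i, hi⟩ _).1 hmem

lemma isTriangulation (hT : IsRegularComplex ν T w₀ h) : IsTriangulation ν T where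
  affineIndependent _ hI := hT.affineIndependent hI
  fullDimensional _ hI := hT.affineSpan_eq hI
  cover := by
    apply Set.Subset.antisymm
    · refine Set.iUnion₂_subset fun I _ => convexHull_mono ?_
      rintro _ ⟨i, -, rfl⟩
      exact ⟨i, rfl⟩
    · intro x hx
      rw [convexHull_range_eq_pts, mem_convexHull_pts_iff] at hx
      obtain ⟨c, h0, -, h1, rfl⟩ := hx
      obtain ⟨I, hI, c', h0', hI', he⟩ := hT.exists_cover c h0
      exact Set.mem_biUnion hI
        (mem_convexHull_pts_iff.2 ⟨c', h0', hI', (hT.sum_eq_of_sum_eq he).trans h1, he⟩)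
  inter := by
    classical
    intro I hI J hJ
    have e : (fun i => toReal (ν i)) '' ((I : Set ι) ∩ (J : Set ι)) = pts ν (I ∩ J) := by
      simp [pts]
    rw [e]
    apply Set.Subset.antisymm
    · rintro x ⟨hx, hx'⟩
      rw [mem_convexHull_pts_iff] at hx hx' ⊢
      obtain ⟨c, h0, hcI, h1, rfl⟩ := hx
      obtain ⟨c', h0', hcJ, h1', he⟩ := hx'
      obtain ⟨m, hm⟩ := hT.mem_liftingCone I hI
      obtain ⟨m', hm'⟩ := hT.mem_liftingCone J hJ
      refine ⟨c', h0', fun i hi => ?_, h1', he⟩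
      by_contra hne
      have hiJ : ∀ i, c' i ≠ 0 → i ∈ J := fun i hi => by
        by_contra hiJ
        exact hi (hcJ i hiJ)
      exact hi (Finset.mem_inter.2 ⟨hm.mem_of_sum_eq hm'.le h0' hcI h0
        (fun i hi => hm'.1 i (hiJ i hi)) he.symm hne, hiJ i hne⟩)
    · refine Set.subset_inter (convexHull_mono ?_) (convexHull_mono ?_)
      · exact Set.image_mono (by simp)
      · exact Set.image_mono (by simp)

lemma isRegularTriangulation (hT : IsRegularComplex ν T w₀ h) : IsRegularTriangulation ν T :=
  ⟨hT.isTriangulation, w₀, (hT.induces_iff w₀).2 hT.mem_liftingCone⟩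

end IsRegularComplex

end Triangulation

/-! ### The toric variety of a subfan as a dense open subscheme. -/

section Subfan

variable {n : ℕ}

/-- The map of semigroup algebras is injective, so its kernel lies in the nilradical. Applied with τ
= 0, this says that the torus is dense in each chart. -/
lemma denseRange_chartHom {τ σ : PointedCone ℝ (Fin n → ℝ)} (h : τ ≤ σ) :
    DenseRange (chartHom h) := by
  have : DenseRange (PrimeSpectrum.comap (chartMap h).toRingHom) := by
    rw [PrimeSpectrum.denseRange_comap_iff_ker_le_nilRadical,
      (RingHom.injective_iff_ker_eq_bot (chartMap h).toRingHom).1 (chartMap_injective h)]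
    exact bot_le
  exact this

variable {Φ Ψ : Fan n}

/-- The morphism of toric varieties induced by the inclusion of a subfan. -/
noncomputable def Fan.inclusion (hsub : Φ.cones ⊆ Ψ.cones) : Φ.toricVariety ⟶ Ψ.toricVariety :=
  colimit.desc Φ.diagram
    { pt := Ψ.toricVariety
      ι := { app := fun σ => Ψ.chartι σ.1 (hsub σ.2)
             naturality := fun σ τ f => by
              refine Eq.trans ?_ (Category.comp_id _).symm
              exact colimit.w Ψ.diagram (j := ⟨τ.1, hsub τ.2⟩) (j' := ⟨σ.1, hsub σ.2⟩)
                (homOfLE (leOfHom f)) } }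

lemma Fan.chartι_inclusion (hsub : Φ.cones ⊆ Ψ.cones) (σ : PointedCone ℝ (Fin n → ℝ))
    (h : σ ∈ Φ.cones) : Φ.chartι σ h ≫ Fan.inclusion hsub = Ψ.chartι σ (hsub h) :=
  colimit.ι_desc _ _

lemma Fan.chartι_str (σ : PointedCone ℝ (Fin n → ℝ)) (h : σ ∈ Φ.cones) :
    Φ.chartι σ h ≫ Φ.str = chartStr σ :=
  colimit.ι_desc _ _

instance Fan.isOpenImmersion_chartι (σ : PointedCone ℝ (Fin n → ℝ)) (h : σ ∈ Φ.cones) :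
    IsOpenImmersion (Φ.chartι σ h) :=
  inferInstanceAs (IsOpenImmersion (colimit.ι Φ.diagram ⟨σ, h⟩))

lemma Fan.exists_chartι_eq (x : Φ.toricVariety) :
    ∃ (σ : PointedCone ℝ (Fin n → ℝ)) (h : σ ∈ Φ.cones) (y : chart σ), Φ.chartι σ h y = x := by
  obtain ⟨σ, y, hy⟩ := Scheme.IsLocallyDirected.ι_jointly_surjective Φ.diagram x
  exact ⟨σ.1, σ.2, y, hy⟩

lemma Fan.inclusion_injective (hsub : Φ.cones ⊆ Ψ.cones) :
    Function.Injective (Fan.inclusion hsub) := by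
  intro x y hxy
  obtain ⟨σ, hσ, x, rfl⟩ := Fan.exists_chartι_eq x
  obtain ⟨τ, hτ, y, rfl⟩ := Fan.exists_chartι_eq y
  rw [← Scheme.Hom.comp_apply, ← Scheme.Hom.comp_apply, Fan.chartι_inclusion,
    Fan.chartι_inclusion] at hxy
  obtain ⟨ρ, fσ, fτ, z, hz, hz'⟩ := (Scheme.IsLocallyDirected.ι_eq_ι_iff Ψ.diagram
    (i := ⟨σ, hsub hσ⟩) (j := ⟨τ, hsub hτ⟩)).1 hxy
  -- Two points identified in the larger variety are identified over a common face, which already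
  -- belongs to the subfan; so no new gluing occurs.
  have hρ : ρ.1 ∈ Φ.cones := Φ.face_mem σ hσ _ (Ψ.isFace_of_le (leOfHom fσ))
  refine (Scheme.IsLocallyDirected.ι_eq_ι_iff Φ.diagram
    (i := ⟨σ, hσ⟩) (j := ⟨τ, hτ⟩)).2
      ⟨⟨ρ.1, hρ⟩, homOfLE (leOfHom fσ), homOfLE (leOfHom fτ), z, hz, hz'⟩

lemma Fan.isOpenImmersion_inclusion (hsub : Φ.cones ⊆ Ψ.cones) :
    IsOpenImmersion (Fan.inclusion hsub) := by
  refine IsOpenImmersion.of_forall_source_exists _ (Fan.inclusion_injective hsub) fun x => ?_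
  obtain ⟨σ, hσ, y, rfl⟩ := Fan.exists_chartι_eq x
  exact ⟨_, Φ.chartι σ hσ, inferInstance, ⟨y, rfl⟩, by
    rw [Fan.chartι_inclusion]; infer_instance⟩

/-- The toric variety of a fan is a partial compactification of that of any subfan. -/
lemma Fan.isPartialCompactification_of_subset (hsub : Φ.cones ⊆ Ψ.cones)
    (hbot : ⊥ ∈ Φ.cones) : IsPartialCompactification Φ Ψ := by
  refine ⟨Fan.inclusion hsub, Fan.isOpenImmersion_inclusion hsub, ⟨fun x => ?_⟩, ?_, hbot,
    hsub hbot, Fan.chartι_inclusion hsub _ _⟩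
  · obtain ⟨σ, hσ, y, rfl⟩ := Fan.exists_chartι_eq x
    have hle : (⊥ : PointedCone ℝ (Fin n → ℝ)) ≤ σ := bot_le
    have hw : chartHom hle ≫ Ψ.chartι σ hσ = Fan.chartι Φ ⊥ hbot ≫ Fan.inclusion hsub := by
      rw [Fan.chartι_inclusion]
      exact colimit.w Ψ.diagram (j := ⟨σ, hσ⟩) (j' := ⟨⊥, hsub hbot⟩) (homOfLE hle)
    have hy := mem_closure_image (Ψ.chartι σ hσ).continuous.continuousAt
      (denseRange_chartHom hle y)
    refine closure_mono ?_ hy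
    rintro _ ⟨_, ⟨z, rfl⟩, rfl⟩
    refine ⟨Φ.chartι ⊥ hbot z, ?_⟩
    rw [← Scheme.Hom.comp_apply, ← hw, Scheme.Hom.comp_apply]
  · refine colimit.hom_ext fun σ => ?_
    change Φ.chartι σ.1 σ.2 ≫ Fan.inclusion hsub ≫ Ψ.str = Φ.chartι σ.1 σ.2 ≫ Φ.str
    rw [← Category.assoc, Fan.chartι_inclusion, Fan.chartι_str, Fan.chartι_str]

end Subfan

/-! ### The fan of cones over a regular complex. -/

section SimplicialFan

variable {ι : Type} {n : ℕ}

lemma coneOf_image_empty (ν : ι → Fin n → ℤ) :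
    coneOf (ν '' ((∅ : Finset ι) : Set ι)) = ⊥ := by
  simp [coneOf]

lemma coneOf_image_mono (ν : ι → Fin n → ℤ) {K J : Finset ι} (h : K ⊆ J) :
    coneOf (ν '' (K : Set ι)) ≤ coneOf (ν '' (J : Set ι)) :=
  Submodule.span_mono (Set.image_mono (Set.image_mono (by exact_mod_cast h)))

variable [Fintype ι]

lemma mem_coneOf_image_iff {ν : ι → Fin n → ℤ} {I : Finset ι} {x : Fin n → ℝ} :
    x ∈ coneOf (ν '' (I : Set ι)) ↔ ∃ c : ι → ℝ, (∀ i, 0 ≤ c i) ∧ (∀ i ∉ I, c i = 0) ∧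
      ∑ i, c i • toReal (ν i) = x := by
  classical
  constructor
  · intro hx
    refine Submodule.span_induction (p := fun x _ => ∃ c : ι → ℝ, (∀ i, 0 ≤ c i) ∧
      (∀ i ∉ I, c i = 0) ∧ ∑ i, c i • toReal (ν i) = x) ?_ ?_ ?_ ?_ hx
    · rintro _ ⟨_, ⟨i, hi, rfl⟩, rfl⟩
      refine ⟨Pi.single i 1, fun j => ?_, fun j hj => ?_, ?_⟩
      · by_cases h : j = i
        · subst h; simp
        · simp [h]
      · have : j ≠ i := by rintro rfl; exact hj hi
        simp [this]
      · simp [Pi.single_apply, ite_smul]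
    · exact ⟨0, fun _ => le_rfl, fun _ _ => rfl, by simp⟩
    · rintro _ _ _ _ ⟨c, h0, hI, rfl⟩ ⟨c', h0', hI', rfl⟩
      exact ⟨c + c', fun i => add_nonneg (h0 i) (h0' i),
        fun i hi => by simp [hI i hi, hI' i hi], by simp [add_smul, Finset.sum_add_distrib]⟩
    · rintro a _ _ ⟨c, h0, hI, rfl⟩
      refine ⟨fun i => (a : ℝ) * c i, fun i => mul_nonneg a.2 (h0 i),
        fun i hi => by simp [hI i hi], ?_⟩
      simp only [mul_smul, ← Finset.smul_sum]
      rfl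
  · rintro ⟨c, h0, hI, rfl⟩
    refine Submodule.sum_mem _ fun i _ => ?_
    by_cases hi : i ∈ I
    · exact Submodule.smul_mem _ (⟨c i, h0 i⟩ : {r : ℝ // 0 ≤ r})
        (Submodule.subset_span ⟨ν i, ⟨i, hi, rfl⟩, rfl⟩)
    · rw [hI i hi, zero_smul]
      exact Submodule.zero_mem _

/-- The faces of a simplicial cone are the cones over the subsets of its generators. -/
lemma IsRationalBasis.isFace_iff {ν : ι → Fin n → ℤ} {I J : Finset ι} (hI : IsRationalBasis ν I)
    (hJ : J ⊆ I) {τ : PointedCone ℝ (Fin n → ℝ)} :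
    IsFace τ (coneOf (ν '' (J : Set ι))) ↔ ∃ K ⊆ J, τ = coneOf (ν '' (K : Set ι)) := by
  classical
  constructor
  · rintro ⟨m, hm, hτ⟩
    refine ⟨J.filter fun i => pairing m (toReal (ν i)) = 0, Finset.filter_subset _ _, ?_⟩
    ext x
    rw [hτ]
    constructor
    · rintro ⟨hx, hx0⟩
      obtain ⟨c, h0, hcJ, rfl⟩ := mem_coneOf_image_iff.1 hx
      refine mem_coneOf_image_iff.2 ⟨c, h0, fun i hi => ?_, rfl⟩
      by_cases hiJ : i ∈ J
      · have hnn : ∀ i ∈ Finset.univ, 0 ≤ c i * pairing m (toReal (ν i)) := fun i _ => by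
          by_cases hiJ : i ∈ J
          · exact mul_nonneg (h0 i) (hm _ (Submodule.subset_span ⟨ν i, ⟨i, hiJ, rfl⟩, rfl⟩))
          · simp [hcJ i hiJ]
        rw [pairing_sum, Finset.sum_eq_zero_iff_of_nonneg hnn] at hx0
        have := hx0 i (Finset.mem_univ i)
        rcases mul_eq_zero.1 this with h | h
        · exact h
        · exact absurd (Finset.mem_filter.2 ⟨hiJ, h⟩) hi
      · exact hcJ i hiJ
    · intro hx
      refine ⟨coneOf_image_mono ν (Finset.filter_subset _ _) hx, ?_⟩
      obtain ⟨c, h0, hcJ, rfl⟩ := mem_coneOf_image_iff.1 hx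
      rw [pairing_sum]
      refine Finset.sum_eq_zero fun i _ => ?_
      by_cases hi : i ∈ J.filter fun i => pairing m (toReal (ν i)) = 0
      · rw [(Finset.mem_filter.1 hi).2, mul_zero]
      · rw [hcJ i hi, zero_mul]
  · rintro ⟨K, hK, rfl⟩
    -- The face on `K` is cut out by a functional vanishing on `K` and positive on the other
    -- generators.
    obtain ⟨d, m, hd, hm⟩ := hI.exists_int_eq fun i => if i ∈ K then 0 else 1
    have hp : ∀ i ∈ J, pairing m (toReal (ν i)) = if i ∈ K then 0 else (d : ℝ) := by
      intro i hi
      rw [pairing_toReal, hm i (hJ hi)]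
      split_ifs <;> simp
    have hd' : (0 : ℝ) < d := by exact_mod_cast hd
    have hnn : ∀ i ∈ J, 0 ≤ pairing m (toReal (ν i)) := fun i hi => by
      rw [hp i hi]
      split_ifs
      · exact le_rfl
      · exact hd'.le
    refine ⟨m, ?_, fun x => ⟨fun hx => ⟨coneOf_image_mono ν hK hx, ?_⟩, ?_⟩⟩
    · apply nonneg_of_generators
      rintro _ ⟨i, hi, rfl⟩
      exact hnn i hi
    · obtain ⟨c, h0, hcK, rfl⟩ := mem_coneOf_image_iff.1 hx
      rw [pairing_sum]
      refine Finset.sum_eq_zero fun i _ => ?_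
      by_cases hi : i ∈ K
      · rw [hp i (hK hi), if_pos hi, mul_zero]
      · rw [hcK i hi, zero_mul]
    · rintro ⟨hx, hx0⟩
      obtain ⟨c, h0, hcJ, rfl⟩ := mem_coneOf_image_iff.1 hx
      refine mem_coneOf_image_iff.2 ⟨c, h0, fun i hi => ?_, rfl⟩
      by_cases hiJ : i ∈ J
      · have hnn' : ∀ i ∈ Finset.univ, 0 ≤ c i * pairing m (toReal (ν i)) := fun i _ => by
          by_cases hiJ : i ∈ J
          · exact mul_nonneg (h0 i) (hnn i hiJ)
          · simp [hcJ i hiJ]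
        rw [pairing_sum, Finset.sum_eq_zero_iff_of_nonneg hnn'] at hx0
        have := hx0 i (Finset.mem_univ i)
        rw [hp i hiJ, if_neg hi] at this
        exact (mul_eq_zero.1 this).resolve_right hd'.ne'
      · exact hcJ i hiJ

/-- The cones over the members of `T` and their subsets. -/
def faceCones (ν : ι → Fin n → ℤ) (T : Finset (Finset ι)) : Set (PointedCone ℝ (Fin n → ℝ)) :=
  {τ | ∃ I ∈ T, ∃ J ⊆ I, τ = coneOf (ν '' (J : Set ι))}

namespace IsRegularComplex

variable {ν : ι → Fin n → ℤ} {T : Finset (Finset ι)} {w₀ : ι → ℝ} {h : Fin n → ℝ}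

/-- Given two expansions of a common point, slackness puts the second into `I`; independence of `I`
then makes the two expansions equal, so the coefficients are carried by both `J` and `J'`. -/
lemma coneOf_inf [DecidableEq ι] (hT : IsRegularComplex ν T w₀ h) {I I' J J' : Finset ι}
    (hI : I ∈ T) (hI' : I' ∈ T) (hJ : J ⊆ I) (hJ' : J' ⊆ I') :
    coneOf (ν '' (J : Set ι)) ⊓ coneOf (ν '' (J' : Set ι)) =
      coneOf (ν '' ((J ∩ J' : Finset ι) : Set ι)) := by
  apply le_antisymm
  · rintro x ⟨hx, hx'⟩
    obtain ⟨c, h0, hcJ, rfl⟩ := mem_coneOf_image_iff.1 hx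
    obtain ⟨c', h0', hcJ', he⟩ := mem_coneOf_image_iff.1 hx'
    obtain ⟨m, hm⟩ := hT.mem_liftingCone I hI
    obtain ⟨m', hm'⟩ := hT.mem_liftingCone I' hI'
    have mem : ∀ i, c' i ≠ 0 → i ∈ J' := fun i hi => by
      by_contra hiJ
      exact hi (hcJ' i hiJ)
    have hcI' : ∀ i ∉ I, c' i = 0 := fun i hi => by
      by_contra hne
      exact hi (hm.mem_of_sum_eq hm'.le h0' (fun i hi => hcJ i fun h => hi (hJ h)) h0
        (fun i hi => hm'.1 i (hJ' (mem i hi))) he.symm hne)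
    have hcc := (hT.basis I hI).eq_of_sum_eq (fun i hi => hcJ i fun h => hi (hJ h)) hcI' he.symm
    refine mem_coneOf_image_iff.2 ⟨c, h0, fun i hi => ?_, rfl⟩
    by_contra hne
    refine hi (Finset.mem_inter.2 ⟨?_, mem i (hcc ▸ hne)⟩)
    by_contra hiJ
    exact hne (hcJ i hiJ)
  · exact le_inf (coneOf_image_mono ν Finset.inter_subset_left)
      (coneOf_image_mono ν Finset.inter_subset_right)

/-- The fan of the cones over the members of a subset `T'` of `T` and their faces. -/
def fan (hT : IsRegularComplex ν T w₀ h) {T' : Finset (Finset ι)} (hsub : T' ⊆ T) : Fan n where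
  cones := faceCones ν T'
  finite := by
    refine (Set.finite_range fun J : Finset ι => coneOf (ν '' (J : Set ι))).subset ?_
    rintro _ ⟨I, -, J, -, rfl⟩
    exact ⟨J, rfl⟩
  rational := by
    rintro _ ⟨I, -, J, -, rfl⟩
    exact ⟨_, J.finite_toSet.image ν, rfl⟩
  stronglyConvex := by
    rintro _ ⟨I, -, J, -, rfl⟩ x hx hx'
    obtain ⟨c, h0, -, rfl⟩ := mem_coneOf_image_iff.1 hx
    obtain ⟨c', h0', -, he⟩ := mem_coneOf_image_iff.1 hx'
    -- Expansions of x and −x add up to a nonnegative expansion of 0, whose coefficients have total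
    -- 0 by height one.
    have hsum : ∑ i, (c i + c' i) = ∑ i, (0 : ι → ℝ) i :=
      hT.sum_eq_of_sum_eq (by simp [add_smul, Finset.sum_add_distrib, he])
    simp only [Pi.zero_apply, Finset.sum_const_zero] at hsum
    rw [Finset.sum_eq_zero_iff_of_nonneg fun i _ => add_nonneg (h0 i) (h0' i)] at hsum
    refine Finset.sum_eq_zero fun i hi => ?_
    have := hsum i hi
    rw [show c i = 0 by linarith [h0 i, h0' i], zero_smul]
  face_mem := by
    rintro _ ⟨I, hI, J, hJ, rfl⟩ τ hτ
    obtain ⟨K, hK, rfl⟩ := ((hT.basis I (hsub hI)).isFace_iff hJ).1 hτ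
    exact ⟨I, hI, K, hK.trans hJ, rfl⟩
  inter_face := by
    classical
    rintro _ ⟨I, hI, J, hJ, rfl⟩ _ ⟨I', hI', J', hJ', rfl⟩
    rw [hT.coneOf_inf (hsub hI) (hsub hI') hJ hJ']
    exact ⟨((hT.basis I (hsub hI)).isFace_iff hJ).2 ⟨_, Finset.inter_subset_left, rfl⟩,
      ((hT.basis I' (hsub hI')).isFace_iff hJ').2 ⟨_, Finset.inter_subset_right, rfl⟩⟩

lemma fan_isGeneratedBy (hT : IsRegularComplex ν T w₀ h) {T' : Finset (Finset ι)} (hsub : T' ⊆ T) :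
    (hT.fan hsub).IsGeneratedBy {σ | ∃ I ∈ T', σ = coneOf (ν '' (I : Set ι))} := by
  ext τ
  constructor
  · rintro ⟨I, hI, J, hJ, rfl⟩
    exact ⟨_, ⟨I, hI, rfl⟩,
      ((hT.basis I (hsub hI)).isFace_iff subset_rfl).2 ⟨J, hJ, rfl⟩⟩
  · rintro ⟨_, ⟨I, hI, rfl⟩, hτ⟩
    obtain ⟨J, hJ, rfl⟩ := ((hT.basis I (hsub hI)).isFace_iff subset_rfl).1 hτ
    exact ⟨I, hI, J, hJ, rfl⟩

lemma isPartialCompactification (hT : IsRegularComplex ν T w₀ h) {T' : Finset (Finset ι)}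
    (hsub : T' ⊆ T) (hne : T'.Nonempty) :
    IsPartialCompactification (hT.fan hsub) (hT.fan subset_rfl) := by
  obtain ⟨I, hI⟩ := hne
  refine Fan.isPartialCompactification_of_subset ?_
    ⟨I, hI, ∅, Finset.empty_subset I, (coneOf_image_empty ν).symm⟩
  rintro _ ⟨I, hI, J, hJ, rfl⟩
  exact ⟨I, hsub hI, J, hJ, rfl⟩

end IsRegularComplex

end SimplicialFan

/-! ### Semistability in terms of monomials and linear functionals. -/

section Semistable

lemma zpow_sum_eq_prod_zpow {G κ : Type*} [CommGroup G] (g : G) (s : Finset κ) (f : κ → ℤ) :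
    g ^ (∑ k ∈ s, f k) = ∏ k ∈ s, g ^ f k := by
  classical
  induction s using Finset.induction_on with
  | empty => simp
  | insert a s ha ih => rw [Finset.sum_insert ha, Finset.prod_insert ha, zpow_add, ih]

variable {ι : Type} [Fintype ι] {n : ℕ}

/-- An integral vector defining the trivial character of the Cox group is orthogonal to all the
relations among the vectors `ν i`. -/
lemma mem_range_charMap_of_torusChar_eq_one {ν : ι → Fin n → ℤ} {v : ι → ℤ}
    (hv : ∀ t ∈ coxGroup ν, torusChar v t = 1) :
    (fun i => (v i : ℝ)) ∈ LinearMap.range (charMap ν) := by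
  classical
  rw [← Subspace.forall_mem_dualAnnihilator_apply_eq_zero_iff]
  intro φ hφ
  rw [Submodule.mem_dualAnnihilator] at hφ
  have expand : ∀ x : ι → ℝ, φ x = ∑ i, φ (Pi.single i 1) * x i := by
    intro x
    conv_lhs => rw [← Finset.univ_sum_single x]
    rw [map_sum]
    refine Finset.sum_congr rfl fun i _ => ?_
    have : (Pi.single i (x i) : ι → ℝ) = x i • Pi.single i (1 : ℝ) := by
      rw [← Pi.single_smul, smul_eq_mul, mul_one]
    rw [this, map_smul, smul_eq_mul, mul_comm]
  -- Exponentiating a real relation among the `ν i` gives a point of the Cox group; triviality of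
  -- the character there says that the relation annihilates `v`.
  let t : ι → ℂˣ := fun i =>
    Units.mk0 ((Real.exp (φ (Pi.single i 1)) : ℝ) : ℂ) (by exact_mod_cast (Real.exp_pos _).ne')
  have prod_t : ∀ u : ι → ℤ, ((∏ i, t i ^ u i : ℂˣ) : ℂ) =
      ((Real.exp (φ fun i => (u i : ℝ)) : ℝ) : ℂ) := by
    intro u
    rw [expand, Real.exp_sum]
    push_cast
    refine Finset.prod_congr rfl fun i _ => ?_
    simp only [t, Units.val_mk0, Complex.ofReal_exp]
    rw [← Complex.exp_int_mul]
    rw [mul_comm]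
  have ht : t ∈ coxGroup ν := by
    intro k
    refine Units.ext ?_
    rw [prod_t fun i => ν i k, show (fun i => ((ν i k : ℤ) : ℝ)) = charMap ν (Pi.single k 1) from
      funext fun i => by simp [charMap_apply, Pi.single_apply], hφ _ ⟨_, rfl⟩]
    simp
  have := congrArg Units.val (hv t ht)
  rw [torusChar, prod_t] at this
  exact (Real.exp_eq_one_iff _).1 (Complex.ofReal_injective (this.trans (by simp)))

/-- A monomial of a semi-invariant polynomial has the same character. -/
lemma torusChar_eq_of_coeff_ne_zero {t : ι → ℂˣ} {z : ℂ} {F : MvPolynomial ι ℂ}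
    (hF : ∀ q : ι → ℂ, MvPolynomial.eval (fun i => (t i : ℂ) * q i) F =
      z * MvPolynomial.eval q F) {b : ι →₀ ℕ} (hb : F.coeff b ≠ 0) :
    ∏ i, (t i : ℂ) ^ b i = z := by
  classical
  -- This is F with its variables rescaled by `t`; comparing coefficients with `z` times F gives the
  -- claim.
  let F' : MvPolynomial ι ℂ :=
    ∑ e ∈ F.support, MvPolynomial.monomial e (F.coeff e * ∏ i, (t i : ℂ) ^ e i)
  have hF' : F' = MvPolynomial.C z * F := by
    refine MvPolynomial.funext fun q => ?_
    rw [map_mul, MvPolynomial.eval_C, ← hF, MvPolynomial.eval_eq' _ F]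
    simp only [F', map_sum, MvPolynomial.eval_monomial, Finsupp.prod_fintype, pow_zero,
      implies_true, mul_pow, Finset.prod_mul_distrib, mul_assoc]
  have := congrArg (MvPolynomial.coeff b) hF'
  rw [MvPolynomial.coeff_C_mul] at this
  simp only [F', MvPolynomial.coeff_sum, MvPolynomial.coeff_monomial, Finset.sum_ite_eq',
    MvPolynomial.mem_support_iff] at this
  rw [if_pos hb, mul_comm z] at this
  exact mul_left_cancel₀ hb this

/-- At a semistable point, the character is a nonnegative combination of the classes of the
nonvanishing coordinates. -/
lemma exists_nonneg_of_mem_semistable {ν : ι → Fin n → ℤ} {a : ι → ℤ} {p : ι → ℂ}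
    (hp : p ∈ semistable ν a) :
    ∃ m : Fin n → ℝ, (∀ i, charMap ν m i ≤ a i) ∧ ∀ i, p i = 0 → charMap ν m i = a i := by
  classical
  obtain ⟨d, hd, F, hF, hne⟩ := hp
  rw [MvPolynomial.eval_eq'] at hne
  obtain ⟨b, hb, hne⟩ := Finset.exists_ne_zero_of_sum_ne_zero hne
  have hb' : F.coeff b ≠ 0 := MvPolynomial.mem_support_iff.1 hb
  have hv : ∀ t ∈ coxGroup ν, torusChar (fun i => (b i : ℤ) - d * a i) t = 1 := by
    intro t ht
    have h1 := torusChar_eq_of_coeff_ne_zero (hF t ht) hb'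
    have h2 : ∏ i, t i ^ b i = torusChar a t ^ d := by
      refine Units.ext ?_
      push_cast
      exact h1
    simp only [torusChar, zpow_sub, zpow_natCast, mul_comm (d : ℤ), zpow_mul,
      Finset.prod_mul_distrib, Finset.prod_inv_distrib] at h2 ⊢
    rw [h2, Finset.prod_pow, mul_inv_cancel]
  obtain ⟨m, hm⟩ := mem_range_charMap_of_torusChar_eq_one hv
  have hd' : (0 : ℝ) < d := by exact_mod_cast hd
  -- The slack of the functional is the exponent vector over `d`: nonnegative, and zero wherever the
  -- point vanishes.
  have key : ∀ i, charMap ν (-(d : ℝ)⁻¹ • m) i = a i - b i / d := by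
    intro i
    rw [map_smul, hm]
    simp only [Pi.smul_apply, smul_eq_mul]
    push_cast
    field_simp
    ring
  refine ⟨-(d : ℝ)⁻¹ • m, fun i => ?_, fun i hi => ?_⟩
  · rw [key]
    have : (0 : ℝ) ≤ b i / d := by positivity
    linarith
  · have : b i = 0 := by
      by_contra hbi
      refine hne ?_
      rw [Finset.prod_eq_zero (Finset.mem_univ i) (by rw [hi, zero_pow hbi]), mul_zero]
    rw [key, this]
    simp

/-- An effective representative of a multiple of the character gives an invariant section. -/
lemma mem_semistable_of_monomial {ν : ι → Fin n → ℤ} {a : ι → ℤ} {p : ι → ℂ} {d : ℕ} (hd : 0 < d)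
    (b : ι → ℕ) (m : Fin n → ℤ) (hb : ∀ i, (b i : ℤ) = d * a i - ∑ k, m k * ν i k)
    (hp : ∀ i, b i ≠ 0 → p i ≠ 0) : p ∈ semistable ν a := by
  refine ⟨d, hd, ∏ i, MvPolynomial.X i ^ b i, fun t ht q => ?_, ?_⟩
  · have h1 : ∏ i, t i ^ b i = torusChar a t ^ d := by
      have e : ∀ i, t i ^ b i = (t i ^ a i) ^ d * (∏ k, (t i ^ ν i k) ^ m k)⁻¹ := by
        intro i
        simp only [← zpow_natCast, hb i, zpow_sub, ← zpow_mul, mul_comm (d : ℤ)]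
        simp only [mul_comm (ν i _)]
        congr 2
        exact zpow_sum_eq_prod_zpow _ _ _
      rw [Finset.prod_congr rfl fun i _ => e i, Finset.prod_mul_distrib, Finset.prod_pow,
        Finset.prod_inv_distrib, Finset.prod_comm]
      have : ∀ k, ∏ i, (t i ^ ν i k) ^ m k = 1 := by
        intro k
        rw [Finset.prod_zpow, ht k, one_zpow]
      simp [this, torusChar]
    have h2 := congrArg Units.val h1
    push_cast at h2
    simp only [map_prod, map_pow, MvPolynomial.eval_X, mul_pow, Finset.prod_mul_distrib, h2]
  · simp only [map_prod, map_pow, MvPolynomial.eval_X]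
    refine Finset.prod_ne_zero_iff.2 fun i _ => ?_
    by_cases hi : b i = 0
    · simp [hi]
    · exact pow_ne_zero _ (hp i hi)

end Semistable

/-! ### The lifting cone as the interior of a chamber. -/

section Chamber

variable {ι : Type} {n : ℕ}

lemma continuous_charMap (ν : ι → Fin n → ℤ) : Continuous (charMap ν) :=
  LinearMap.continuous_of_finiteDimensional _

lemma charClass_eq_iff {ν : ι → Fin n → ℤ} {w w' : ι → ℝ} :
    charClass ν w = charClass ν w' ↔ ∃ m, w = w' + charMap ν m := by
  rw [charClass, charClass, Submodule.mkQ_apply, Submodule.mkQ_apply, Submodule.Quotient.eq]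
  constructor
  · rintro ⟨m, hm⟩
    exact ⟨m, by rw [hm]; abel⟩
  · rintro ⟨m, rfl⟩
    exact ⟨m, by abel⟩

/-- The weights for which every member of `T` lies in a lower facet. -/
def closedLiftingCone (ν : ι → Fin n → ℤ) (T : Finset (Finset ι)) : Set (ι → ℝ) :=
  {w | ∀ I ∈ T, ∃ m, (∀ i ∈ I, charMap ν m i = w i) ∧ ∀ i, charMap ν m i ≤ w i}

/-- The points with nonvanishing coordinates off some member of `T`. -/
def stableSet (T : Finset (Finset ι)) : Set (ι → ℂ) :=
  {p | ∃ I ∈ T, ∀ i, i ∉ I → p i ≠ 0}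

lemma liftingCone_subset_closed (ν : ι → Fin n → ℤ) (T : Finset (Finset ι)) :
    liftingCone ν T ⊆ closedLiftingCone ν T := fun _ hw I hI =>
  (hw I hI).imp fun _ hm => ⟨hm.1, hm.le⟩

lemma smul_mem_liftingCone {ν : ι → Fin n → ℤ} {T : Finset (Finset ι)} {w : ι → ℝ}
    (hw : w ∈ liftingCone ν T) {r : ℝ} (hr : 0 < r) : r • w ∈ liftingCone ν T := by
  intro I hI
  obtain ⟨m, hm⟩ := hw I hI
  refine ⟨r • m, fun i hi => ?_, fun i hi => ?_⟩
  · simp [hm.1 i hi]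
  · simpa using mul_lt_mul_of_pos_left (hm.2 i hi) hr

lemma smul_mem_closedLiftingCone {ν : ι → Fin n → ℤ} {T : Finset (Finset ι)} {w : ι → ℝ}
    (hw : w ∈ closedLiftingCone ν T) {r : ℝ} (hr : 0 ≤ r) : r • w ∈ closedLiftingCone ν T := by
  intro I hI
  obtain ⟨m, hm⟩ := hw I hI
  refine ⟨r • m, fun i hi => ?_, fun i => ?_⟩
  · simp [hm.1 i hi]
  · simpa using mul_le_mul_of_nonneg_left (hm.2 i) hr

lemma add_charMap_mem_closedLiftingCone {ν : ι → Fin n → ℤ} {T : Finset (Finset ι)} {w : ι → ℝ}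
    (hw : w ∈ closedLiftingCone ν T) (m : Fin n → ℝ) :
    w + charMap ν m ∈ closedLiftingCone ν T := by
  intro I hI
  obtain ⟨m', hm⟩ := hw I hI
  exact ⟨m' + m, fun i hi => by simp [hm.1 i hi], fun i => by simpa using hm.2 i⟩

/-- Weak inequalities plus strict ones are strict. This is what identifies the interior of the
closed lifting cone. -/
lemma add_mem_liftingCone {ν : ι → Fin n → ℤ} {T : Finset (Finset ι)} {w w' : ι → ℝ}
    (hw : w ∈ closedLiftingCone ν T) (hw' : w' ∈ liftingCone ν T) :
    w + w' ∈ liftingCone ν T := by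
  intro I hI
  obtain ⟨m, hm⟩ := hw I hI
  obtain ⟨m', hm'⟩ := hw' I hI
  refine ⟨m + m', fun i hi => ?_, fun i hi => ?_⟩
  · simp [hm.1 i hi, hm'.1 i hi]
  · simpa using add_lt_add_of_le_of_lt (hm.2 i) (hm'.2 i hi)

variable [Fintype ι]

/-- Every nonempty open set contains a positive multiple of an integral vector. -/
lemma exists_smul_int_mem {O : Set (ι → ℝ)} (hO : IsOpen O) (hne : O.Nonempty) :
    ∃ (r : ℝ) (b : ι → ℤ), 0 < r ∧ (r • fun i => (b i : ℝ)) ∈ O := by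
  have hd : DenseRange (Pi.map fun _ : ι => ((↑) : ℚ → ℝ)) :=
    DenseRange.piMap fun _ => Rat.denseRange_cast
  obtain ⟨q, hq⟩ := hd.exists_mem_open hO hne
  obtain ⟨D, hD⟩ := IsLocalization.exist_integer_multiples_of_finite (nonZeroDivisors ℤ) q
  choose b hb using hD
  have hD0 : (D : ℤ) ≠ 0 := nonZeroDivisors.coe_ne_zero D
  have hb' : ∀ i, (b i : ℝ) = (D : ℤ) * (q i : ℝ) := by
    intro i
    have := hb i
    simp only [algebraMap_int_eq, eq_intCast, Algebra.smul_def] at this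
    exact_mod_cast congrArg (fun x : ℚ => (x : ℝ)) this
  -- The common denominator `D` may be negative; scaling by its square keeps the factor positive.
  refine ⟨((D : ℤ) ^ 2 : ℝ)⁻¹, fun i => D * b i, by positivity, ?_⟩
  convert hq using 1
  funext i
  have : ((D : ℤ) : ℝ) ≠ 0 := by exact_mod_cast hD0
  simp only [Pi.smul_apply, smul_eq_mul, Int.cast_mul, hb', Pi.map_apply]
  field_simp

/-- A character whose semistable locus contains `stableSet T` lies in the closed lifting cone. -/
lemma mem_closedLiftingCone_of_subset {ν : ι → Fin n → ℤ} {T : Finset (Finset ι)} {b : ι → ℤ}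
    (hb : stableSet T ⊆ semistable ν b) :
    (fun i => (b i : ℝ)) ∈ closedLiftingCone ν T := by
  classical
  intro I hI
  -- Test on the point vanishing exactly on `I`: the resulting functional is tight on all of `I`.
  obtain ⟨m, hle, heq⟩ := exists_nonneg_of_mem_semistable
    (hb (⟨I, hI, fun i hi => by simp [hi]⟩ :
      (fun i => if i ∈ I then 0 else 1 : ι → ℂ) ∈ stableSet T))
  exact ⟨m, fun i hi => heq i (by simp [hi]), hle⟩

namespace IsRegularComplex

variable {ν : ι → Fin n → ℤ} {T : Finset (Finset ι)} {w₀ : ι → ℝ} {h : Fin n → ℝ}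

lemma isOpen_liftingCone (hT : IsRegularComplex ν T w₀ h) : IsOpen (liftingCone ν T) := by
  have : liftingCone ν T = ⋂ I ∈ T, {w | ∃ m, Supports ν w I m} := by
    ext w; simp [liftingCone]
  rw [this]
  refine isOpen_biInter_finset fun I hI => ?_
  obtain ⟨M, hM⟩ := (hT.basis I hI).exists_interpolation
  -- The values of the functional are determined by those on the basis `I`, so it may be taken
  -- linear in `w`, leaving finitely many strict inequalities.
  have e : {w | ∃ m, Supports ν w I m} = ⋂ i : {i // i ∉ I}, {w | charMap ν (M w) i < w i} := by
    ext w
    simp only [Set.mem_iInter, Set.mem_ofPred_eq, Subtype.forall]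
    constructor
    · rintro ⟨m, hm⟩ i hi
      rw [(hT.basis I hI).charMap_ext fun j hj => (hM w j hj).trans (hm.1 j hj).symm]
      exact hm.2 i hi
    · exact fun hw => ⟨M w, hM w, hw⟩
  rw [e]
  refine isOpen_iInter_of_finite fun i => isOpen_lt ?_ (continuous_apply _)
  exact (continuous_apply _).comp
    ((continuous_charMap ν).comp (LinearMap.continuous_of_finiteDimensional M))

lemma isClosed_closedLiftingCone (hT : IsRegularComplex ν T w₀ h) :
    IsClosed (closedLiftingCone ν T) := by
  have : closedLiftingCone ν T = ⋂ I ∈ T,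
      {w | ∃ m, (∀ i ∈ I, charMap ν m i = w i) ∧ ∀ i, charMap ν m i ≤ w i} := by
    ext w; simp [closedLiftingCone]
  rw [this]
  refine isClosed_biInter fun I hI => ?_
  obtain ⟨M, hM⟩ := (hT.basis I hI).exists_interpolation
  have e : {w | ∃ m, (∀ i ∈ I, charMap ν m i = w i) ∧ ∀ i, charMap ν m i ≤ w i} =
      ⋂ i, {w | charMap ν (M w) i ≤ w i} := by
    ext w
    simp only [Set.mem_iInter, Set.mem_ofPred_eq]
    constructor
    · rintro ⟨m, hm⟩ i
      rw [(hT.basis I hI).charMap_ext fun j hj => (hM w j hj).trans (hm.1 j hj).symm]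
      exact hm.2 i
    · exact fun hw => ⟨M w, hM w, hw⟩
  rw [e]
  refine isClosed_iInter fun i => isClosed_le ?_ (continuous_apply _)
  exact (continuous_apply _).comp
    ((continuous_charMap ν).comp (LinearMap.continuous_of_finiteDimensional M))

lemma interior_closedLiftingCone (hT : IsRegularComplex ν T w₀ h) :
    interior (closedLiftingCone ν T) = liftingCone ν T := by
  apply Set.Subset.antisymm
  · intro w hw
    -- For small t > 0 the weight w − t·w₀ is still in the closed cone, and adding back t·w₀ makes
    -- all inequalities strict.
    have hcont : Continuous fun t : ℝ => w - t • w₀ := by fun_prop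
    have hev := (hcont.tendsto 0).eventually
      (by simpa using mem_interior_iff_mem_nhds.1 hw :
        closedLiftingCone ν T ∈ nhds (w - (0 : ℝ) • w₀))
    obtain ⟨t, h1, h2⟩ := ((hev.filter_mono nhdsWithin_le_nhds).and
      (self_mem_nhdsWithin : Set.Ioi (0 : ℝ) ∈ nhdsWithin 0 (Set.Ioi 0))).exists
    have := add_mem_liftingCone h1 (smul_mem_liftingCone hT.mem_liftingCone h2)
    simpa using this
  · exact interior_maximal (liftingCone_subset_closed ν T) hT.isOpen_liftingCone

/-- The semistable locus of a character in the lifting cone. -/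
lemma semistable_eq (hT : IsRegularComplex ν T w₀ h) {a : ι → ℤ}
    (ha : (fun i => (a i : ℝ)) ∈ liftingCone ν T) : semistable ν a = stableSet T := by
  classical
  apply Set.Subset.antisymm
  · intro p hp
    obtain ⟨m, hle, heq⟩ := exists_nonneg_of_mem_semistable hp
    obtain ⟨I, hI, hsub⟩ := hT.exists_subset_of_tight ha
      (Finset.univ.filter fun i => p i = 0) m hle fun i hi => heq i (by simpa using hi)
    exact ⟨I, hI, fun i hi hpi => hi (hsub (by simpa using hpi))⟩
  · rintro p ⟨I, hI, hp⟩
    obtain ⟨d, m, hd, hm⟩ := (hT.basis I hI).exists_int_eq a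
    obtain ⟨m', hm'⟩ := ha I hI
    have hmZ : ∀ i, charMap ν (toReal m) i = ((∑ k, m k * ν i k : ℤ) : ℝ) := fun i => by
      rw [← pairing_eq_charMap, pairing_toReal]
    have hcmp : ∀ i, charMap ν (toReal m) i = d * charMap ν m' i := by
      intro i
      have := (hT.basis I hI).charMap_ext (m := toReal m) (m' := (d : ℝ) • m') (fun j hj => by
        rw [hmZ, hm j hj, map_smul, Pi.smul_apply, hm'.1 j hj]
        simp) i
      simpa using this
    have hnn : ∀ i, 0 ≤ d * a i - ∑ k, m k * ν i k := by
      intro i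
      have h1 : ((∑ k, m k * ν i k : ℤ) : ℝ) ≤ ((d * a i : ℤ) : ℝ) := by
        rw [← hmZ, hcmp]
        push_cast
        exact mul_le_mul_of_nonneg_left (hm'.le i) (Nat.cast_nonneg d)
      have h2 : ∑ k, m k * ν i k ≤ d * a i := by exact_mod_cast h1
      linarith
    refine mem_semistable_of_monomial hd (fun i => (d * a i - ∑ k, m k * ν i k).toNat) m
      (fun i => Int.toNat_of_nonneg (hnn i)) fun i hi => hp i fun hiI => hi ?_
    rw [hm i hiI]
    simp

lemma stableSet_nonempty (hT : IsRegularComplex ν T w₀ h) : (stableSet T).Nonempty := by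
  obtain ⟨I, hI⟩ := hT.nonempty
  exact ⟨1, I, hI, fun i _ => one_ne_zero⟩

/-- The classes of the weights in the lifting cone form the interior of the GKZ cone of any
character with semistable locus `stableSet T`. -/
lemma charClass_mem_interior_iff (hT : IsRegularComplex ν T w₀ h) {a : ι → ℤ}
    (ha : semistable ν a = stableSet T) (w : ι → ℝ) :
    charClass ν w ∈ interior (gkzCone ν a) ↔ w ∈ liftingCone ν T := by
  have hopen : IsOpenMap (charClass ν) :=
    (LinearMap.range (charMap ν)).isOpenMap_mkQ
  have hcont : Continuous (charClass ν) :=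
    (LinearMap.range (charMap ν)).isOpenQuotientMap_mkQ.continuous
  -- The quotient map is open and continuous, so closure and interior can be computed on weight
  -- vectors.
  rw [← Set.mem_preimage, hopen.preimage_interior_eq_interior_preimage hcont, gkzCone,
    hopen.preimage_closure_eq_closure_preimage hcont]
  set V := charClass ν ⁻¹' {x | ∃ (r : ℝ) (b : ι → ℤ), 0 < r ∧
    semistable ν b = semistable ν a ∧ x = r • charClass ν fun i => (b i : ℝ)} with hV
  have h1 : closure V ⊆ closedLiftingCone ν T := by
    refine closure_minimal ?_ hT.isClosed_closedLiftingCone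
    rintro w ⟨r, b, hr, hb, hw⟩
    have hw' : charClass ν w = charClass ν (r • fun i => (b i : ℝ)) :=
      hw.trans (map_smul (LinearMap.range (charMap ν)).mkQ r _).symm
    obtain ⟨m, rfl⟩ := charClass_eq_iff.1 hw'
    exact add_charMap_mem_closedLiftingCone (smul_mem_closedLiftingCone
      (mem_closedLiftingCone_of_subset (hb.trans ha).ge) hr.le) m
  have h2 : liftingCone ν T ⊆ closure V := by
    intro w hw
    rw [mem_closure_iff]
    intro O hO hwO
    obtain ⟨r, b, hr, hbO, hbT⟩ :=
      exists_smul_int_mem (hO.inter hT.isOpen_liftingCone) ⟨w, hwO, hw⟩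
    refine ⟨_, hbO, r, b, hr, ?_, map_smul (LinearMap.range (charMap ν)).mkQ r _⟩
    rw [ha, hT.semistable_eq]
    simpa [smul_smul, inv_mul_cancel₀ hr.ne'] using smul_mem_liftingCone hbT (inv_pos.2 hr)
  constructor
  · intro hw
    rw [← hT.interior_closedLiftingCone]
    exact interior_mono h1 hw
  · exact fun hw => interior_maximal h2 hT.isOpen_liftingCone hw

/-- A GKZ cone containing this one has a character of its own locus near the class of `w₀`, hence in
the lifting cone. The two loci then agree, and so do the cones. -/
lemma isChamber_gkzCone (hT : IsRegularComplex ν T w₀ h) {a : ι → ℤ}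
    (ha : semistable ν a = stableSet T) : IsChamber ν (gkzCone ν a) := by
  refine ⟨⟨a, ha ▸ hT.stableSet_nonempty, rfl⟩, ?_⟩
  rintro _ ⟨b, -, rfl⟩ hle
  have hmem : charClass ν w₀ ∈ interior (gkzCone ν a) :=
    (hT.charClass_mem_interior_iff ha w₀).2 hT.mem_liftingCone
  have hcl : charClass ν w₀ ∈ gkzCone ν b := hle (interior_subset hmem)
  obtain ⟨_, hx, r, b', hr, hb', rfl⟩ := mem_closure_iff.1 hcl _ isOpen_interior hmem
  have e : r • charClass ν (fun i => (b' i : ℝ)) = charClass ν (r • fun i => (b' i : ℝ)) :=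
    (map_smul (LinearMap.range (charMap ν)).mkQ r _).symm
  rw [e, hT.charClass_mem_interior_iff ha] at hx
  have hb'' : (fun i => (b' i : ℝ)) ∈ liftingCone ν T := by
    simpa [smul_smul, inv_mul_cancel₀ hr.ne'] using smul_mem_liftingCone hx (inv_pos.2 hr)
  have hss : semistable ν b = semistable ν a := by
    rw [ha, ← hb', hT.semistable_eq hb'']
  simp only [gkzCone, hss, le_refl]

/-- A regular complex corresponds to a chamber of the GKZ fan. -/
lemma exists_chamber (hT : IsRegularComplex ν T w₀ h) :
    ∃ σ, IsChamber ν σ ∧ Corresponds ν σ T := by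
  obtain ⟨r, a, hr, ha⟩ := exists_smul_int_mem hT.isOpen_liftingCone ⟨w₀, hT.mem_liftingCone⟩
  have ha' : semistable ν a = stableSet T := by
    rw [hT.semistable_eq]
    simpa [smul_smul, inv_mul_cancel₀ hr.ne'] using smul_mem_liftingCone ha (inv_pos.2 hr)
  refine ⟨gkzCone ν a, hT.isChamber_gkzCone ha', fun w => ?_, fun b hb => ?_⟩
  · rw [hT.charClass_mem_interior_iff ha', hT.induces_iff]
  · exact hT.semistable_eq ((hT.charClass_mem_interior_iff ha' _).1 hb)

end IsRegularComplex

end Chamber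

/-! ### The explicit certificate: simplices, dual bases, weight and relations. -/

section Data

/-- The vertices of the simplices of the triangulation. -/
def vertex : Fin 18 → Fin 7 → Fin 12 ⊕ Fin 2 :=
  ![![P 0, P 1, P 2, P 3, P 4, P 9, S₂],
    ![P 0, P 1, P 2, P 3, P 4, S₁, S₂],
    ![P 0, P 1, P 2, P 3, P 5, P 9, S₂],
    ![P 0, P 1, P 2, P 3, P 5, S₁, S₂],
    ![P 0, P 1, P 2, P 4, P 5, P 10, S₂],
    ![P 0, P 1, P 2, P 4, P 5, S₁, S₂],
    ![P 0, P 1, P 2, P 4, P 9, P 10, S₂],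
    ![P 0, P 1, P 2, P 5, P 9, P 11, S₂],
    ![P 0, P 1, P 2, P 5, P 10, P 11, S₂],
    ![P 0, P 1, P 3, P 4, P 5, P 7, S₁],
    ![P 0, P 1, P 3, P 4, P 5, S₁, S₂],
    ![P 0, P 2, P 3, P 4, P 5, P 8, S₁],
    ![P 0, P 2, P 3, P 4, P 5, S₁, S₂],
    ![P 0, P 3, P 4, P 5, P 6, P 7, S₁],
    ![P 0, P 3, P 4, P 5, P 6, P 8, S₁],
    ![P 1, P 2, P 3, P 4, P 5, P 8, S₁],
    ![P 1, P 2, P 3, P 4, P 5, S₁, S₂],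
    ![P 1, P 3, P 4, P 5, P 7, P 8, S₁]]

/-- Nine times the dual basis of the vertices of each simplex. -/
def dualVector : Fin 18 → Fin 7 → Fin 7 → ℤ :=
  ![![![3, 0, 0, 0, 0, 3, 0], ![0, 3, 0, 0, 0, 3, 0], ![0, 0, 3, 0, 0, 3, 0],
      ![-3, -3, -3, -3, -6, 9, 0], ![3, 3, 3, 3, 6, 0, 0], ![6, 6, 6, 9, 9, -9, 0],
      ![-9, -9, -9, -9, -9, 0, 9]],
    ![![5, 2, 2, 3, 3, 0, 0], ![2, 5, 2, 3, 3, 0, 0], ![2, 2, 5, 3, 3, 0, 0],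
      ![3, 3, 3, 6, 3, 0, 0], ![3, 3, 3, 3, 6, 0, 0], ![-6, -6, -6, -9, -9, 9, 0],
      ![-9, -9, -9, -9, -9, 0, 9]],
    ![![3, 0, 0, 0, 0, 3, 0], ![0, 3, 0, 0, 0, 3, 0], ![0, 0, 3, 0, 0, 3, 0],
      ![3, 3, 3, 3, 6, 9, 0], ![-3, -3, -3, -3, -6, 0, 0], ![-3, -3, -3, 0, -9, -9, 0],
      ![0, 0, 0, 0, 9, 0, 9]],
    ![![2, -1, -1, 0, -3, 0, 0], ![-1, 2, -1, 0, -3, 0, 0], ![-1, -1, 2, 0, -3, 0, 0],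
      ![0, 0, 0, 3, -3, 0, 0], ![-3, -3, -3, -3, -6, 0, 0], ![3, 3, 3, 0, 9, 9, 0],
      ![0, 0, 0, 0, 9, 0, 9]],
    ![![3, 0, 0, 0, 0, 3, 0], ![0, 3, 0, 0, 0, 3, 0], ![0, 0, 3, 0, 0, 3, 0],
      ![3, 3, 3, 6, 3, 9, 0], ![-3, -3, -3, -6, -3, 0, 0], ![-3, -3, -3, -9, 0, -9, 0],
      ![0, 0, 0, 9, 0, 0, 9]],
    ![![2, -1, -1, -3, 0, 0, 0], ![-1, 2, -1, -3, 0, 0, 0], ![-1, -1, 2, -3, 0, 0, 0],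
      ![0, 0, 0, -3, 3, 0, 0], ![-3, -3, -3, -6, -3, 0, 0], ![3, 3, 3, 9, 0, 9, 0],
      ![0, 0, 0, 9, 0, 0, 9]],
    ![![3, 0, 0, 0, 0, 3, 0], ![0, 3, 0, 0, 0, 3, 0], ![0, 0, 3, 0, 0, 3, 0],
      ![0, 0, 0, 0, 0, 9, 0], ![3, 3, 3, 6, 3, 0, 0], ![3, 3, 3, 3, 6, -9, 0],
      ![-9, -9, -9, -9, -9, 0, 9]],
    ![![3, 0, 0, 0, 0, 3, 0], ![0, 3, 0, 0, 0, 3, 0], ![0, 0, 3, 0, 0, 3, 0],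
      ![0, 0, 0, 0, 0, 9, 0], ![0, 0, 0, 3, -3, 0, 0], ![-3, -3, -3, -3, -6, -9, 0],
      ![0, 0, 0, 0, 9, 0, 9]],
    ![![3, 0, 0, 0, 0, 3, 0], ![0, 3, 0, 0, 0, 3, 0], ![0, 0, 3, 0, 0, 3, 0],
      ![0, 0, 0, 0, 0, 9, 0], ![0, 0, 0, -3, 3, 0, 0], ![-3, -3, -3, -6, -3, -9, 0],
      ![0, 0, 0, 9, 0, 0, 9]],
    ![![3, 0, -3, 0, 0, 0, 0], ![-3, 0, 3, 0, 0, 0, 9], ![0, 0, 0, 3, 0, 0, 3],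
      ![0, 0, 0, 0, 3, 0, 3], ![-3, -3, -3, -3, -3, 0, 3], ![3, 3, -6, 0, 0, 0, -9],
      ![0, 0, 9, 0, 0, 9, 0]],
    ![![3, 0, -3, 0, 0, 0, 0], ![0, 3, -3, 0, 0, 0, 0], ![1, 1, -2, 3, 0, 0, 0],
      ![1, 1, -2, 0, 3, 0, 0], ![-2, -2, -5, -3, -3, 0, 0], ![0, 0, 9, 0, 0, 9, 0],
      ![-3, -3, 6, 0, 0, 0, 9]],
    ![![3, -3, 0, 0, 0, 0, 0], ![-3, 3, 0, 0, 0, 0, 9], ![0, 0, 0, 3, 0, 0, 3],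
      ![0, 0, 0, 0, 3, 0, 3], ![-3, -3, -3, -3, -3, 0, 3], ![3, -6, 3, 0, 0, 0, -9],
      ![0, 9, 0, 0, 0, 9, 0]],
    ![![3, -3, 0, 0, 0, 0, 0], ![0, -3, 3, 0, 0, 0, 0], ![1, -2, 1, 3, 0, 0, 0],
      ![1, -2, 1, 0, 3, 0, 0], ![-2, -5, -2, -3, -3, 0, 0], ![0, 9, 0, 0, 0, 9, 0],
      ![-3, 6, -3, 0, 0, 0, 9]],
    ![![0, 0, 0, 0, 0, 0, 9], ![0, 0, 0, 3, 0, 0, 3], ![0, 0, 0, 0, 3, 0, 3],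
      ![-3, -3, -3, -3, -3, 0, 3], ![3, 0, -3, 0, 0, 0, -9], ![0, 3, -3, 0, 0, 0, 0],
      ![0, 0, 9, 0, 0, 9, 0]],
    ![![0, 0, 0, 0, 0, 0, 9], ![0, 0, 0, 3, 0, 0, 3], ![0, 0, 0, 0, 3, 0, 3],
      ![-3, -3, -3, -3, -3, 0, 3], ![3, -3, 0, 0, 0, 0, -9], ![0, -3, 3, 0, 0, 0, 0],
      ![0, 9, 0, 0, 0, 9, 0]],
    ![![-3, 3, 0, 0, 0, 0, 0], ![3, -3, 0, 0, 0, 0, 9], ![0, 0, 0, 3, 0, 0, 3],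
      ![0, 0, 0, 0, 3, 0, 3], ![-3, -3, -3, -3, -3, 0, 3], ![-6, 3, 3, 0, 0, 0, -9],
      ![9, 0, 0, 0, 0, 9, 0]],
    ![![-3, 3, 0, 0, 0, 0, 0], ![-3, 0, 3, 0, 0, 0, 0], ![-2, 1, 1, 3, 0, 0, 0],
      ![-2, 1, 1, 0, 3, 0, 0], ![-5, -2, -2, -3, -3, 0, 0], ![9, 0, 0, 0, 0, 9, 0],
      ![6, -3, -3, 0, 0, 0, 9]],
    ![![0, 0, 0, 0, 0, 0, 9], ![0, 0, 0, 3, 0, 0, 3], ![0, 0, 0, 0, 3, 0, 3],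
      ![-3, -3, -3, -3, -3, 0, 3], ![-3, 3, 0, 0, 0, 0, -9], ![-3, 0, 3, 0, 0, 0, 0],
      ![9, 0, 0, 0, 0, 9, 0]]]

/-- A weight vector inducing the triangulation. -/
def weight : Fin 12 ⊕ Fin 2 → ℤ :=
  Sum.elim ![7, 8, 9, -3, -4, -5, 7, 7, 7, 7, 7, 7] ![0, 0]

/-- Relations among the points whose negative parts are the minimal nonfaces of the
triangulation. -/
def relation : Fin 28 → Fin 12 ⊕ Fin 2 → ℤ :=
  ![Sum.elim ![1, -1, 0, 0, 0, 0, -1, 1, 0, 0, 0, 0] ![0, 0],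
    Sum.elim ![1, 0, -1, 0, 0, 0, -1, 0, 1, 0, 0, 0] ![0, 0],
    Sum.elim ![0, 1, -1, 0, 0, 0, 0, -1, 1, 0, 0, 0] ![0, 0],
    Sum.elim ![0, 0, 0, -1, 1, 0, 0, 0, 0, 1, -1, 0] ![0, 0],
    Sum.elim ![0, 0, 0, -1, 0, 1, 0, 0, 0, 1, 0, -1] ![0, 0],
    Sum.elim ![0, 0, 0, 0, -1, 1, 0, 0, 0, 0, 1, -1] ![0, 0],
    Sum.elim ![1, 0, 0, 1, 0, 0, -1, 0, 0, -1, 0, 0] ![0, 0],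
    Sum.elim ![1, 0, 0, 0, 1, 0, -1, 0, 0, 0, -1, 0] ![0, 0],
    Sum.elim ![1, 0, 0, 0, 0, 1, -1, 0, 0, 0, 0, -1] ![0, 0],
    Sum.elim ![3, 0, 0, 1, 1, 1, -3, 0, 0, 0, 0, 0] ![0, -3],
    Sum.elim ![0, 1, 0, 1, 0, 0, 0, -1, 0, -1, 0, 0] ![0, 0],
    Sum.elim ![0, 1, 0, 0, 1, 0, 0, -1, 0, 0, -1, 0] ![0, 0],
    Sum.elim ![0, 1, 0, 0, 0, 1, 0, -1, 0, 0, 0, -1] ![0, 0],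
    Sum.elim ![0, 3, 0, 1, 1, 1, 0, -3, 0, 0, 0, 0] ![0, -3],
    Sum.elim ![0, 0, 1, 1, 0, 0, 0, 0, -1, -1, 0, 0] ![0, 0],
    Sum.elim ![0, 0, 1, 0, 1, 0, 0, 0, -1, 0, -1, 0] ![0, 0],
    Sum.elim ![0, 0, 1, 0, 0, 1, 0, 0, -1, 0, 0, -1] ![0, 0],
    Sum.elim ![0, 0, 3, 1, 1, 1, 0, 0, -3, 0, 0, 0] ![0, -3],
    Sum.elim ![1, 1, 1, 3, 0, 0, 0, 0, 0, -3, 0, 0] ![-3, 0],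
    Sum.elim ![1, 1, 1, 0, 3, 0, 0, 0, 0, 0, -3, 0] ![-3, 0],
    Sum.elim ![1, 1, 1, 0, 0, 3, 0, 0, 0, 0, 0, -3] ![-3, 0],
    Sum.elim ![-1, -1, 2, 0, 0, 0, 0, 0, -3, 0, 0, 0] ![3, 0],
    Sum.elim ![-1, 0, 1, 0, 0, 0, 0, -1, -2, 0, 0, 0] ![3, 0],
    Sum.elim ![0, 0, 0, 2, -1, -1, 0, 0, 0, -3, 0, 0] ![0, 3],
    Sum.elim ![0, 0, 0, 0, 1, -1, 0, 0, 0, -1, -2, 0] ![0, 3],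
    Sum.elim ![0, 0, 0, 0, 0, 0, -1, -1, -1, 0, 0, 0] ![3, 0],
    Sum.elim ![0, 0, 0, 0, 0, 0, 0, 0, 0, -1, -1, -1] ![0, 3],
    Sum.elim ![-1, -1, -1, -1, -1, -1, 0, 0, 0, 0, 0, 0] ![3, 3]]

/-- The minimal nonfaces of the triangulation. -/
def nonface : Fin 28 → Finset (Fin 12 ⊕ Fin 2) :=
  ![{P 1, P 6}, {P 2, P 6}, {P 2, P 7}, {P 3, P 10}, {P 3, P 11}, {P 4, P 11}, {P 6, P 9},
    {P 6, P 10}, {P 6, P 11}, {P 6, S₂}, {P 7, P 9}, {P 7, P 10}, {P 7, P 11}, {P 7, S₂},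
    {P 8, P 9}, {P 8, P 10}, {P 8, P 11}, {P 8, S₂}, {P 9, S₁}, {P 10, S₁}, {P 11, S₁},
    {P 0, P 1, P 8}, {P 0, P 7, P 8}, {P 4, P 5, P 9}, {P 5, P 9, P 10}, {P 6, P 7, P 8},
    {P 9, P 10, P 11}, {P 0, P 1, P 2, P 3, P 4, P 5}]

set_option synthInstance.maxSize 2000 in
set_option synthInstance.maxHeartbeats 400000 in
set_option maxRecDepth 4000 in
/-- A set of points containing none of the minimal nonfaces is contained in a simplex. The Boolean
`bi` says whether the point number `i` belongs to the set. -/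
lemma avoids_complement_of_avoids_nonfaces :
    ∀ b6 b7 b8 : Bool, (b6 && b7 && b8) = false →
    ∀ b9 : Bool, (b6 && b9) = false → (b7 && b9) = false → (b8 && b9) = false →
    ∀ b10 : Bool, (b6 && b10) = false → (b7 && b10) = false → (b8 && b10) = false →
    ∀ b11 : Bool, (b6 && b11) = false → (b7 && b11) = false → (b8 && b11) = false →
      (b9 && b10 && b11) = false →
    ∀ b12 : Bool, (b9 && b12) = false → (b10 && b12) = false → (b11 && b12) = false →
    ∀ b13 : Bool, (b6 && b13) = false → (b7 && b13) = false → (b8 && b13) = false →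
    ∀ b0 : Bool, (b0 && b7 && b8) = false →
    ∀ b1 : Bool, (b1 && b6) = false → (b0 && b1 && b8) = false →
    ∀ b2 : Bool, (b2 && b6) = false → (b2 && b7) = false →
    ∀ b3 : Bool, (b3 && b10) = false → (b3 && b11) = false →
    ∀ b4 : Bool, (b4 && b11) = false →
    ∀ b5 : Bool, (b4 && b5 && b9) = false → (b5 && b9 && b10) = false →
      (b0 && b1 && b2 && b3 && b4 && b5) = false →
    ((b6 || b7 || b8 || b10 || b11 || b12 || b5) &&
    (b6 || b7 || b8 || b9 || b10 || b11 || b5) &&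
    (b6 || b7 || b8 || b10 || b11 || b12 || b4) &&
    (b6 || b7 || b8 || b9 || b10 || b11 || b4) &&
    (b6 || b7 || b8 || b9 || b11 || b12 || b3) &&
    (b6 || b7 || b8 || b9 || b10 || b11 || b3) &&
    (b6 || b7 || b8 || b11 || b12 || b3 || b5) &&
    (b6 || b7 || b8 || b10 || b12 || b3 || b4) &&
    (b6 || b7 || b8 || b9 || b12 || b3 || b4) &&
    (b6 || b8 || b9 || b10 || b11 || b13 || b2) &&
    (b6 || b7 || b8 || b9 || b10 || b11 || b2) &&
    (b6 || b7 || b9 || b10 || b11 || b13 || b1) &&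
    (b6 || b7 || b8 || b9 || b10 || b11 || b1) &&
    (b8 || b9 || b10 || b11 || b13 || b1 || b2) &&
    (b7 || b9 || b10 || b11 || b13 || b1 || b2) &&
    (b6 || b7 || b9 || b10 || b11 || b13 || b0) &&
    (b6 || b7 || b8 || b9 || b10 || b11 || b0) &&
    (b6 || b9 || b10 || b11 || b13 || b0 || b2)) = false := by
  -- Each constraint stands right after its last variable is introduced, so a branch is dropped as
  -- soon as it contains a nonface.
  decide +kernel

lemma dualVector_mul_vertex : ∀ k a b, ∑ x, dualVector k a x * nabla (vertex k b) x =
    if a = b then 9 else 0 := by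
  decide +kernel

/-- The inner sum is nine times the functional interpolating the weight on simplex `k`, which keeps
the comparison integral. -/
lemma weight_support : ∀ k j, (∃ a, vertex k a = j) ∨
    ∑ x, (∑ a, weight (vertex k a) * dualVector k a x) * nabla j x < 9 * weight j := by
  decide +kernel

lemma mem_nonface_of_relation_neg : ∀ r i, relation r i < 0 → i ∈ nonface r := by
  decide +kernel

/-- The relations are combinations of P₆ + P₇ + P₈ = 3S₁, P₉ + P₁₀ + P₁₁ = 3S₂ and the fact that the
differences P_i − P_{6+i} (i ≤ 2) and P_{6+j} − P_j (3 ≤ j ≤ 5) are all equal. -/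
lemma sum_relation : ∀ r x, ∑ i, relation r i * nabla i x = 0 := by
  decide +kernel

/-- In the first six relations, which exchange P_i and P_{6+i}, the equal weights of P₆, …, P₁₁
cancel; the distinct weights 7, 8, 9 and −3, −4, −5 decide the sign. -/
lemma sum_relation_mul_weight : ∀ r, ∑ i, relation r i * weight i < 0 := by
  decide +kernel

end Data

/-! ### Checking the certificate and comparing with the total space over X_LT. -/

section Main

/-- The triangulation of the fourteen points. -/
def triangulation : Finset (Finset (Fin 12 ⊕ Fin 2)) :=
  Finset.univ.image fun k => Finset.univ.image (vertex k)

/-- The points off the simplices of the triangulation. -/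
def nonvertex : Fin 18 → Finset (Fin 12 ⊕ Fin 2) :=
  ![{P 6, P 7, P 8, P 10, P 11, S₁, P 5},
    {P 6, P 7, P 8, P 9, P 10, P 11, P 5},
    {P 6, P 7, P 8, P 10, P 11, S₁, P 4},
    {P 6, P 7, P 8, P 9, P 10, P 11, P 4},
    {P 6, P 7, P 8, P 9, P 11, S₁, P 3},
    {P 6, P 7, P 8, P 9, P 10, P 11, P 3},
    {P 6, P 7, P 8, P 11, S₁, P 3, P 5},
    {P 6, P 7, P 8, P 10, S₁, P 3, P 4},
    {P 6, P 7, P 8, P 9, S₁, P 3, P 4},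
    {P 6, P 8, P 9, P 10, P 11, S₂, P 2},
    {P 6, P 7, P 8, P 9, P 10, P 11, P 2},
    {P 6, P 7, P 9, P 10, P 11, S₂, P 1},
    {P 6, P 7, P 8, P 9, P 10, P 11, P 1},
    {P 8, P 9, P 10, P 11, S₂, P 1, P 2},
    {P 7, P 9, P 10, P 11, S₂, P 1, P 2},
    {P 6, P 7, P 9, P 10, P 11, S₂, P 0},
    {P 6, P 7, P 8, P 9, P 10, P 11, P 0},
    {P 6, P 9, P 10, P 11, S₂, P 0, P 2}]

lemma vertex_or_mem_nonvertex : ∀ k i, (∃ a, vertex k a = i) ∨ i ∈ nonvertex k := by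
  decide +kernel

lemma exists_simplex_of_avoids_nonfaces (p : Fin 12 ⊕ Fin 2 → Bool)
    (hp : ∀ r, ∃ i ∈ nonface r, p i = false) :
    ∃ k, ∀ i, (∃ a, vertex k a = i) ∨ p i = false := by
  have of_nonvertex : ∀ k, (∀ i ∈ nonvertex k, p i = false) →
      ∃ k, ∀ i, (∃ a, vertex k a = i) ∨ p i = false :=
    fun k h => ⟨k, fun i => (vertex_or_mem_nonvertex k i).imp_right (h i)⟩
  simp only [Fin.forall_fin_succ, nonface] at hp
  -- Avoidance of each nonface is kept as a single Boolean conjunction, the form required by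
  -- `avoids_complement_of_avoids_nonfaces`.
  simp [-Bool.and_eq_false_imp, ← Bool.and_eq_false_iff, ← Bool.and_assoc] at hp
  obtain ⟨h0, h1, h2, h3, h4, h5, h6, h7, h8, h9, h10, h11, h12, h13, h14, h15, h16, h17, h18, h19,
    h20,
    h21, h22, h23, h24, h25, h26, h27⟩ := hp
  have key := avoids_complement_of_avoids_nonfaces _ _ _ h25 _ h6 h10 h14 _ h7
    h11 h15 _ h8 h12 h16 h26 _ h18 h19 h20 _ h9 h13 h17 _ h22 _ h0
    h21 _ h1 h2 _ h3 h4 _ h5 _ h23 h24 h27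
  simp only [Bool.and_eq_false_iff, Bool.or_eq_false_iff, or_assoc, and_assoc] at key
  rcases key with h | h | h | h | h | h | h | h | h | h | h | h | h | h | h | h | h | h
  · exact of_nonvertex 0 (by simpa [nonvertex] using h)
  · exact of_nonvertex 1 (by simpa [nonvertex] using h)
  · exact of_nonvertex 2 (by simpa [nonvertex] using h)
  · exact of_nonvertex 3 (by simpa [nonvertex] using h)
  · exact of_nonvertex 4 (by simpa [nonvertex] using h)
  · exact of_nonvertex 5 (by simpa [nonvertex] using h)
  · exact of_nonvertex 6 (by simpa [nonvertex] using h)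
  · exact of_nonvertex 7 (by simpa [nonvertex] using h)
  · exact of_nonvertex 8 (by simpa [nonvertex] using h)
  · exact of_nonvertex 9 (by simpa [nonvertex] using h)
  · exact of_nonvertex 10 (by simpa [nonvertex] using h)
  · exact of_nonvertex 11 (by simpa [nonvertex] using h)
  · exact of_nonvertex 12 (by simpa [nonvertex] using h)
  · exact of_nonvertex 13 (by simpa [nonvertex] using h)
  · exact of_nonvertex 14 (by simpa [nonvertex] using h)
  · exact of_nonvertex 15 (by simpa [nonvertex] using h)
  · exact of_nonvertex 16 (by simpa [nonvertex] using h)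
  · exact of_nonvertex 17 (by simpa [nonvertex] using h)

/-- The height function `x ↦ x₆ + x₇` of the fourteen points, all of height one. -/
def height : Fin 7 → ℤ := ![0, 0, 0, 0, 0, 1, 1]

lemma sum_height : ∀ i, ∑ x, height x * nabla i x = 1 := by
  decide +kernel

lemma vertex_injective (k : Fin 18) : Function.Injective (vertex k) := by
  intro a b h
  have h1 := dualVector_mul_vertex k a a
  rw [h, dualVector_mul_vertex] at h1
  by_contra hab
  simp [hab] at h1

lemma isRationalBasis_vertex (k : Fin 18) :
    IsRationalBasis nabla (Finset.univ.image (vertex k)) := by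
  have hinv := Function.leftInverse_invFun (vertex_injective k)
  refine ⟨by rw [Finset.card_image_of_injective _ (vertex_injective k)]; simp, 9,
    fun i => dualVector k (Function.invFun (vertex k) i), by norm_num, ?_, ?_⟩
  · intro i hi
    obtain ⟨a, -, rfl⟩ := Finset.mem_image.1 hi
    simp only [hinv a]
    rw [dualVector_mul_vertex, if_pos rfl]
  · intro i hi j hj hij
    obtain ⟨a, -, rfl⟩ := Finset.mem_image.1 hi
    obtain ⟨b, -, rfl⟩ := Finset.mem_image.1 hj
    simp only [hinv a]
    rw [dualVector_mul_vertex, if_neg fun h : a = b => hij (h ▸ rfl)]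

lemma supports_vertex (k : Fin 18) : Supports nabla (fun i => (weight i : ℝ))
    (Finset.univ.image (vertex k))
    ((9 : ℝ)⁻¹ • toReal fun x => ∑ a, weight (vertex k a) * dualVector k a x) := by
  have e : ∀ j, charMap nabla ((9 : ℝ)⁻¹ • toReal fun x =>
      ∑ a, weight (vertex k a) * dualVector k a x) j =
      9⁻¹ * ((∑ x, (∑ a, weight (vertex k a) * dualVector k a x) * nabla j x : ℤ) : ℝ) := by
    intro j
    rw [map_smul, Pi.smul_apply, ← pairing_eq_charMap, pairing_toReal, smul_eq_mul]
  refine ⟨fun i hi => ?_, fun i hi => ?_⟩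
  · obtain ⟨b, -, rfl⟩ := Finset.mem_image.1 hi
    have : ∑ x, (∑ a, weight (vertex k a) * dualVector k a x) * nabla (vertex k b) x =
        9 * weight (vertex k b) := by
      simp only [Finset.sum_mul]
      rw [Finset.sum_comm]
      simp only [mul_assoc, ← Finset.mul_sum, dualVector_mul_vertex]
      simp [mul_comm]
    rw [e, this]
    push_cast
    ring
  · rcases weight_support k i with ⟨a, rfl⟩ | h
    · exact absurd (Finset.mem_image_of_mem _ (Finset.mem_univ a)) hi
    · rw [e]
      have : ((∑ x, (∑ a, weight (vertex k a) * dualVector k a x) * nabla i x : ℤ) : ℝ) <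
          9 * weight i := by exact_mod_cast h
      linarith

lemma isRegularComplex_triangulation :
    IsRegularComplex nabla triangulation (fun i => (weight i : ℝ)) (toReal height) where
  height i := by rw [← pairing_eq_charMap, pairing_toReal, sum_height, Int.cast_one]
  basis I hI := by
    obtain ⟨k, -, rfl⟩ := Finset.mem_image.1 hI
    exact isRationalBasis_vertex k
  mem_liftingCone I hI := by
    obtain ⟨k, -, rfl⟩ := Finset.mem_image.1 hI
    exact ⟨_, supports_vertex k⟩
  improve J hJ := by
    -- If `J` contained the negative part of no relation, it would contain no listed nonface and
    -- hence lie in a simplex.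
    obtain ⟨r, hr⟩ : ∃ r, ∀ i, relation r i < 0 → i ∈ J := by
      by_contra! hno
      obtain ⟨k, hk⟩ := exists_simplex_of_avoids_nonfaces (fun i => decide (i ∈ J)) fun r => by
        obtain ⟨i, hi, hiJ⟩ := hno r
        exact ⟨i, mem_nonface_of_relation_neg r i hi, by simpa using hiJ⟩
      refine hJ _ (Finset.mem_image_of_mem _ (Finset.mem_univ k)) fun i hi => ?_
      rcases hk i with ⟨a, rfl⟩ | h
      · exact Finset.mem_image_of_mem _ (Finset.mem_univ a)
      · simp [hi] at h
    refine ⟨fun i => (relation r i : ℝ), ?_, fun i hi => hr i (Int.cast_lt_zero.1 hi), ?_⟩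
    · funext x
      simp only [Finset.sum_apply, Pi.smul_apply, toReal, smul_eq_mul, Pi.zero_apply]
      exact_mod_cast sum_relation r x
    · have := sum_relation_mul_weight r
      dsimp only
      exact_mod_cast this

lemma T₀_subset_triangulation : T₀ ⊆ triangulation := by
  decide +kernel

/-- Every simplex contains S₁ or S₂. Those with both form `T₀`, those with S₂ alone satisfy (A), and
those with S₁ alone satisfy (B). -/
lemma condA_or_condB_of_mem : ∀ I ∈ triangulation, I ∉ T₀ → CondA I ∨ CondB I := by
  unfold CondA CondB
  decide +kernel

/-- The generators of the fan of the total space over `X_LT` are among the fourteen points. -/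
lemma totCone_eq (I : Finset (Fin 6)) : totCone rhoLT (-divBLT) (-divALT) I =
    coneOf (nabla '' ((I.image (fun i => P (Fin.castLE (by norm_num) i)) ∪ {S₁, S₂} :
      Finset (Fin 12 ⊕ Fin 2)) : Set (Fin 12 ⊕ Fin 2))) := by
  have h1 : ∀ i, totRays rhoLT (-divBLT) (-divALT) (Sum.inl i) =
      nabla (P (Fin.castLE (by norm_num) i)) := by decide +kernel
  have h2 : ∀ j, totRays rhoLT (-divBLT) (-divALT) (Sum.inr j) = nabla (Sum.inr j) := by
    decide +kernel
  rw [totCone]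
  congr 1
  ext x
  simp [Set.image_union, h1, h2, or_comm, or_assoc, eq_comm]

lemma maxConesLT_eq : maxConesLT = simplexCones T₀ := by
  have hT₀ : ∀ J : Finset (Fin 12 ⊕ Fin 2), J ∈ T₀ ↔ ∃ I : Finset (Fin 6), I.card = 5 ∧
      J = I.image (fun i => P (Fin.castLE (by norm_num) i)) ∪ {S₁, S₂} := by
    have e : T₀ = (Finset.univ.powersetCard 5).image fun I : Finset (Fin 6) =>
        I.image (fun i => P (Fin.castLE (by norm_num) i)) ∪ {S₁, S₂} := by decide +kernel
    intro J
    simp [e, Finset.mem_powersetCard, eq_comm]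
  ext σ
  constructor
  · rintro ⟨I, hI, rfl⟩
    exact ⟨_, (hT₀ _).2 ⟨I, hI, rfl⟩, totCone_eq I⟩
  · rintro ⟨J, hJ, rfl⟩
    obtain ⟨I, hI, rfl⟩ := (hT₀ J).1 hJ
    exact ⟨I, hI, (totCone_eq I).symm⟩

end Main

end GKZ

theorem proposition4p1 :
    ∃ (σ : Set (GKZ.CharSpace GKZ.nabla)) (T : Finset (Finset (Fin 12 ⊕ Fin 2))),
      GKZ.IsChamber GKZ.nabla σ ∧
      GKZ.IsRegularTriangulation GKZ.nabla T ∧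
      GKZ.Corresponds GKZ.nabla σ T ∧
      GKZ.T₀ ⊆ T ∧
      (∀ I ∈ T, I ∉ GKZ.T₀ → GKZ.CondA I ∨ GKZ.CondB I) ∧
      ∃ Φ Ψ : GKZ.Fan 7,
        Φ.IsGeneratedBy GKZ.maxConesLT ∧
        Ψ.IsGeneratedBy (GKZ.simplexCones T) ∧
        GKZ.IsPartialCompactification Φ Ψ := by
  have hT := GKZ.isRegularComplex_triangulation
  have hsub := GKZ.T₀_subset_triangulation
  obtain ⟨σ, hσ, hσT⟩ := hT.exists_chamber
  refine ⟨σ, GKZ.triangulation, hσ, hT.isRegularTriangulation, hσT, hsub,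
    GKZ.condA_or_condB_of_mem, hT.fan hsub, hT.fan subset_rfl, ?_,
    hT.fan_isGeneratedBy subset_rfl, hT.isPartialCompactification hsub ?_⟩
  · rw [GKZ.maxConesLT_eq]
    exact hT.fan_isGeneratedBy hsub
  · decide +kernel
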